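/- Let $H_1=\mathbb R^3$ be the Heisenberg group with $\mathring e_1=\partial_x+y\,\partial_z$, $\mathring e_2=\partial_y-x\,\partial_z$, $T=\partial_z$, contact form $\Theta=dz+x\,dy-y\,dx$, contact bundle $\xi=\ker\Theta$, $J\mathring e_1=\mathring e_2$, $J\mathring e_2=-\mathring e_1$ on $\xi$, the metric for which $\mathring e_1,\mathring e_2,T$ are orthonormal, and the connection $\nabla$ for which they are parallel. Everything is $C^\infty$. A point $p$ of an embedded surface $\Sigma\subset H_1$ is singular if $T_p\Sigma=\xi_p$. On a surface without singular points let $e_1$ be a chosen unit vector field in $T\Sigma\cap\xi$, and put $e_2=Je_1$; the $p$-mean curvature $H$ and the $\alpha$-function are defined by $\nabla_{e_1}e_2=-He_1$ and $\alpha e_2+T\in T\Sigma$; $\hat e_1=e_1$ and $\hat e_2=(\alpha e_2+T)/\sqrt{1+\alpha^2}$ form an orthonormal frame of $T\Sigma$. Coordinates $(x,y)$ on an open subset of $\Sigma$ are compatible if $e_1=\partial/\partial x$. A Heisenberg rigid motion is a diffeomorphism of $H_1$ preserving $\Theta$ and $J$. Fix $c\in\mathbb R$ and consider $$\alpha_{xx}+6\alpha\alpha_x+4\alpha^3+c^2\alpha=0.\qquad(*)$$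 (1) There is a non-empty surface without singular points in $H_1$ with $H=c$ if and only if $(*)$ has a smooth solution $\alpha(x,y)$ on some non-empty open subset of $\mathbb R^2$. (2) Let $\Sigma$, with the characteristic direction $e_1$, be a surface without singular points with $H=c$. Then every point of $\Sigma$ has a compatible coordinate system around it, the $\alpha$-function exists, and in every compatible coordinate system it is a smooth solution of $(*)$. (3) Let $\alpha$ be a smooth solution of $(*)$ on an open set $U\subset\mathbb R^2$, and let $u_0\in U$. On some neighbourhood of $u_0$ there are smooth antiderivatives with respect to $x$, $E=\int 2\alpha\,dx$ and $G=\int c\,\alpha\, e^{E}dx$. For any such $E,G$ on an open set $V$ with $u_0\in V\subset U$, and any smooth functions $k(y)$, $h(y)$ on the projection of $V$ to the $y$-axis, there are an open set $W$ with $u_0\in W\subset V$ and an embedding $X:W\to H_1$ such that $X(W)$ is a surface without singular points with $H=c$, with $\alpha$ as its $\alpha$-function, $\hat e_1=\partial/\partial x$ and $\hat e_2=a\,\partial/\partial x+b\,\partial/\partial y$, where $$a=\frac{e^{-E}}{\sqrt{1+\alpha^2}}\,\bigl(h(y)-G\bigr),\qquad b=e^{k(y)}\frac{e^{-E}}{\sqrt{1+\alpha^2}};$$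 hence the induced metric is $\bigl(dx-\tfrac ab\,dy\bigr)^2+\bigl(\tfrac1b\,dy\bigr)^2$. (4) Conversely, let $V\subset\mathbb R^2$ be an open set whose sections $\{x:(x,y)\in V\}$ are connected or empty, and let $X:V\to H_1$ be an embedding whose image is a surface without singular points with $H=c$, $\alpha$-function $\alpha$ and $\hat e_1=\partial/\partial x$. Then $\hat e_2=a\,\partial/\partial x+b\,\partial/\partial y$ with smooth $a,b$, $b\ne0$, the induced metric is $(dx-\frac ab dy)^2+(\frac1b dy)^2$, and for any smooth antiderivatives $E,G$ on $V$ as in (3) there are unique functions $k(y),h(y)$ on the projection of $V$ to the $y$-axis such that $a$ and $|b|$ are given by the formulas of (3) for $a$ and $b$; these $k,h$ are smooth. (5) If two embeddings of a connected open set $V$ are as in (4) (without the condition on sections), with the same $c,\alpha,a,b$, then they differ by a Heisenberg rigid motion. -/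

import Mathlib

open Set Filter Topology
open scoped ContDiff

noncomputable section

namespace Heis

/-! ### The Heisenberg group as a pseudohermitian manifold -/

/-- The underlying manifold `ℝ³` of the Heisenberg group, with coordinates `(x, y, z)`; it also
serves as the tangent space at each point, in the coordinate basis `∂/∂x, ∂/∂y, ∂/∂z`. -/
abbrev H1 : Type := ℝ × ℝ × ℝ

/-- The left invariant vector field `∂/∂x + y ∂/∂z`. -/
def frame1 (P : H1) : H1 := (1, 0, P.2.1)

/-- The left invariant vector field `∂/∂y - x ∂/∂z`. -/
def frame2 (P : H1) : H1 := (0, 1, -P.1)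

/-- The vector field `T = ∂/∂z`. -/
def reeb (_ : H1) : H1 := (0, 0, 1)

/-- The contact form `Θ = dz + x dy - y dx`. -/
def contactForm (P : H1) : H1 →ₗ[ℝ] ℝ where
  toFun v := v.2.2 + P.1 * v.2.1 - P.2.1 * v.1
  map_add' v w := by simp only [Prod.fst_add, Prod.snd_add]; ring
  map_smul' r v := by
    simp only [Prod.smul_fst, Prod.smul_snd, smul_eq_mul, RingHom.id_apply]; ring

/-- The contact plane `ξ_P = ker Θ_P`. -/
def contactPlane (P : H1) : Submodule ℝ H1 := LinearMap.ker (contactForm P)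

/-- The components of a vector in the frame `frame1, frame2, reeb`. -/
theorem frame_expansion (P v : H1) :
    v = v.1 • frame1 P + v.2.1 • frame2 P + contactForm P v • reeb P := by
  obtain ⟨a, b, c⟩ := v
  simp only [frame1, frame2, reeb, contactForm, LinearMap.coe_mk, AddHom.coe_mk, Prod.smul_mk,
    Prod.mk_add_mk, smul_eq_mul, Prod.mk.injEq]
  refine ⟨by ring, by ring, by ring⟩

/-- The contact plane is spanned by `frame1` and `frame2`. -/
theorem contactPlane_eq_span (P : H1) :
    contactPlane P = Submodule.span ℝ {frame1 P, frame2 P} := by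
  ext v
  rw [Submodule.mem_span_pair, contactPlane, LinearMap.mem_ker]
  constructor
  · intro h
    refine ⟨v.1, v.2.1, ?_⟩
    conv_rhs => rw [frame_expansion P v, h]
    simp
  · rintro ⟨a, b, rfl⟩
    simp only [frame1, frame2, contactForm, LinearMap.coe_mk, AddHom.coe_mk, Prod.smul_mk,
      Prod.mk_add_mk, smul_eq_mul]
    ring

/-- The CR structure: `J frame1 = frame2` and `J frame2 = -frame1`. It is only ever used on the
contact plane (the formula extends it by `J T = 0`). -/
def cxJ (P v : H1) : H1 := v.1 • frame2 P - v.2.1 • frame1 P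

/-- The adapted metric: `frame1, frame2, reeb` are orthonormal. -/
def adaptedMetric (P v w : H1) : ℝ :=
  v.1 * w.1 + v.2.1 * w.2.1 + contactForm P v * contactForm P w

/-- The covariant derivative, at time `t`, of a vector field `V` along a curve `γ`, for the
connection for which `frame1, frame2, reeb` are parallel. -/
def covDerivAlong (γ V : ℝ → H1) (t : ℝ) : H1 :=
  deriv (fun s => (V s).1) t • frame1 (γ t) + deriv (fun s => (V s).2.1) t • frame2 (γ t)
    + deriv (fun s => contactForm (γ s) (V s)) t • reeb (γ t)

/-- Heisenberg rigid motions: diffeomorphisms that preserve `(J, Θ)`. -/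
structure IsRigidMotion (Φ : H1 ≃ H1) : Prop where
  smooth : ContDiff ℝ ∞ Φ
  smooth_symm : ContDiff ℝ ∞ Φ.symm
  preserves_contactForm : ∀ P v : H1, contactForm (Φ P) (fderiv ℝ Φ P v) = contactForm P v
  preserves_J : ∀ P : H1, ∀ v ∈ contactPlane P,
    fderiv ℝ Φ P (cxJ P v) = cxJ (Φ P) (fderiv ℝ Φ P v)

/-! ### Surfaces -/

/-- `X` is a smooth embedding of the open set `U ⊆ ℝ²` into `H1`. -/
structure IsSmoothEmbedding (U : Set (ℝ × ℝ)) (X : ℝ × ℝ → H1) : Prop where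
  isOpen : IsOpen U
  smooth : ContDiffOn ℝ ∞ X U
  immersion : ∀ u ∈ U, Function.Injective (fderiv ℝ X u)
  embedding : IsEmbedding (U.domRestrict X)

/-- `(U, X)` is a local parametrization of `S`, that is, `X⁻¹` is a coordinate system on the
relatively open subset `X(U)` of `S`. -/
structure IsChart (S : Set H1) (U : Set (ℝ × ℝ)) (X : ℝ × ℝ → H1) : Prop where
  isSmoothEmbedding : IsSmoothEmbedding U X
  image_eq : ∃ O : Set H1, IsOpen O ∧ X '' U = S ∩ O

/-- `S` is a smooth (embedded) surface. -/
def IsSurface (S : Set H1) : Prop :=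
  ∀ p ∈ S, ∃ U X, IsChart S U X ∧ p ∈ X '' U

/-- `γ` is (near time `0`) a smooth curve in `S` with `γ(0) = p` and `γ'(0) = v`. -/
structure IsCurveIn (S : Set H1) (p v : H1) (γ : ℝ → H1) : Prop where
  smooth : ContDiffAt ℝ ∞ γ 0
  mem : ∀ᶠ t in 𝓝 (0 : ℝ), γ t ∈ S
  pos : γ 0 = p
  vel : deriv γ 0 = v

/-- The tangent plane `T_p S`, as the set of velocities of smooth curves in `S`. -/
def tangentPlane (S : Set H1) (p : H1) : Set H1 := {v | ∃ γ, IsCurveIn S p v γ}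

/-- `p` is a singular point of `S`: the tangent plane is the contact plane. -/
def IsSingularPoint (S : Set H1) (p : H1) : Prop :=
  tangentPlane S p = (contactPlane p : Set H1)

/-- `e` is a smooth unit vector field on `S` that is tangent to the characteristic foliation
`TS ∩ ξ` (a choice of the characteristic direction `e₁`). -/
structure IsCharacteristicField (S : Set H1) (e : H1 → H1) : Prop where
  tangent : ∀ p ∈ S, e p ∈ tangentPlane S p
  horizontal : ∀ p ∈ S, e p ∈ contactPlane p
  unit : ∀ p ∈ S, adaptedMetric p (e p) (e p) = 1
  smooth : ∀ U X, IsChart S U X → ContDiffOn ℝ ∞ (fun u => e (X u)) U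

/-- `H` is the p-mean curvature of `S` with respect to the characteristic direction `e`:
`∇_{e₁} e₂ = -H e₁` with `e₁ = e` and `e₂ = J e₁`. -/
def IsPMeanCurvature (S : Set H1) (e : H1 → H1) (H : H1 → ℝ) : Prop :=
  ∀ p ∈ S, ∀ γ, IsCurveIn S p (e p) γ →
    covDerivAlong γ (fun t => cxJ (γ t) (e (γ t))) 0 = -H p • e p

/-- `α` is the α-function of `S` with respect to the characteristic direction `e`:
`α e₂ + T` is tangent to `S`. -/
def IsAlphaFunction (S : Set H1) (e : H1 → H1) (α : H1 → ℝ) : Prop :=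
  ∀ p ∈ S, α p • cxJ p (e p) + reeb p ∈ tangentPlane S p

/-- `S`, with the characteristic direction `e`, is a surface without singular points whose
p-mean curvature is the constant `c`. -/
structure IsCMCSurface (c : ℝ) (S : Set H1) (e : H1 → H1) : Prop where
  isSurface : IsSurface S
  no_singular : ∀ p ∈ S, ¬ IsSingularPoint S p
  characteristic : IsCharacteristicField S e
  curvature : IsPMeanCurvature S e (fun _ => c)

/-! ### Compatible coordinates -/

/-- The coordinate vector field `∂/∂x`, seen in `H1`. -/
def dX (X : ℝ × ℝ → H1) (u : ℝ × ℝ) : H1 := fderiv ℝ X u (1, 0)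

/-- The coordinate vector field `∂/∂y`, seen in `H1`. -/
def dY (X : ℝ × ℝ → H1) (u : ℝ × ℝ) : H1 := fderiv ℝ X u (0, 1)

/-- A compatible coordinate system on `S`: one with `e₁ = ∂/∂x`. -/
structure IsCompatibleChart (S : Set H1) (e : H1 → H1) (U : Set (ℝ × ℝ)) (X : ℝ × ℝ → H1) :
    Prop where
  isChart : IsChart S U X
  compatible : ∀ u ∈ U, dX X u = e (X u)

/-- The partial derivative in `x`. -/
def partialX (f : ℝ × ℝ → ℝ) (u : ℝ × ℝ) : ℝ := deriv (fun t => f (t, u.2)) u.1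

/-- `α` is a (smooth) solution on `U` of `α_xx + 6 α α_x + 4 α³ + c² α = 0`. -/
def IsLienardSolution (c : ℝ) (U : Set (ℝ × ℝ)) (α : ℝ × ℝ → ℝ) : Prop :=
  ContDiffOn ℝ ∞ α U ∧ ∀ u ∈ U,
    partialX (partialX α) u + 6 * α u * partialX α u + 4 * α u ^ 3 + c ^ 2 * α u = 0

/-- `X : U → H1` is an embedding whose image is a surface without singular points with p-mean
curvature `c` and α-function `α` (written in the coordinates of `U`), where the characteristic
direction is `∂/∂x`. -/
def IsRealization (c : ℝ) (α : ℝ × ℝ → ℝ) (U : Set (ℝ × ℝ)) (X : ℝ × ℝ → H1) : Prop :=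
  IsSmoothEmbedding U X ∧ ∃ (e : H1 → H1) (A : H1 → ℝ),
    IsCMCSurface c (X '' U) e ∧ IsCompatibleChart (X '' U) e U X ∧
    IsAlphaFunction (X '' U) e A ∧ ∀ u ∈ U, A (X u) = α u

/-- `ê₂ = a ∂/∂x + b ∂/∂y`, where `ê₂ = (α e₂ + T) / √(1 + α²)`, `e₂ = J e₁`, `e₁ = ∂/∂x`. -/
def HasFrameCoeffs (α : ℝ × ℝ → ℝ) (U : Set (ℝ × ℝ)) (X : ℝ × ℝ → H1) (a b : ℝ × ℝ → ℝ) : Prop :=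
  ∀ u ∈ U, (1 / √(1 + α u ^ 2)) • (α u • cxJ (X u) (dX X u) + reeb (X u))
    = a u • dX X u + b u • dY X u

/-- The induced metric is the one for which `∂/∂x, a ∂/∂x + b ∂/∂y` is an orthonormal frame,
that is, `(dx - (a/b) dy)² + ((1/b) dy)²`. -/
def HasInducedMetric (U : Set (ℝ × ℝ)) (X : ℝ × ℝ → H1) (a b : ℝ × ℝ → ℝ) : Prop :=
  ∀ u ∈ U, adaptedMetric (X u) (dX X u) (dX X u) = 1 ∧
    adaptedMetric (X u) (dX X u) (dY X u) = -(a u / b u) ∧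
    adaptedMetric (X u) (dY X u) (dY X u) = (a u / b u) ^ 2 + (1 / b u) ^ 2

/-- `F` is a smooth antiderivative of `f` on `U` with respect to `x`. -/
def IsAntiderivX (f F : ℝ × ℝ → ℝ) (U : Set (ℝ × ℝ)) : Prop :=
  ContDiffOn ℝ ∞ F U ∧ ∀ u ∈ U, HasDerivAt (fun t => F (t, u.2)) (f u) u.1

/-- `E` is an antiderivative `∫ 2α dx`, and `G` an antiderivative `∫ c α e^{∫ 2α dx} dx`. -/
def AreAntiderivs (c : ℝ) (α E G : ℝ × ℝ → ℝ) (U : Set (ℝ × ℝ)) : Prop :=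
  IsAntiderivX (fun u => 2 * α u) E U ∧ IsAntiderivX (fun u => c * α u * Real.exp (E u)) G U

/-- `a = e^{-∫ 2α dx} (h(y) - ∫ c α e^{∫ 2α dx} dx) / √(1 + α²)`. -/
def coeffA (α E G : ℝ × ℝ → ℝ) (h : ℝ → ℝ) (u : ℝ × ℝ) : ℝ :=
  Real.exp (-E u) / √(1 + α u ^ 2) * (h u.2 - G u)

/-- `b = e^{k(y)} e^{-∫ 2α dx} / √(1 + α²)`. -/
def coeffB (α E : ℝ × ℝ → ℝ) (k : ℝ → ℝ) (u : ℝ × ℝ) : ℝ :=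
  Real.exp (k u.2) * (Real.exp (-E u) / √(1 + α u ^ 2))

end Heis

end

/-! In compatible coordinates `∂X/∂x` is a horizontal unit vector, so its horizontal components are
locally (cos θ, sin θ), and H = c says θ_x = c. Write m = Θ(X_y), n = -⟨X_x, X_y⟩, w = ⟨J X_x, X_y⟩
and φ = θ_y (`contactY`, `shiftY`, `normalY`, `angleY`). Absence of singular points means m ≠ 0, and
tangency of α e₂ + T means w = α m. Equality of mixed derivatives then gives the linear system m_x =
2αm, n_x = -cαm, w_x = φ + cn, φ_x = 0. Putting w = αm into the third equation gives m α_x + 2α²m =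
φ + cn, and one more derivative in x gives m times the Liénard equation
(`StructureEqs.isLienardSolution`).

Conversely, the first two equations are solved by m = e^{E-k(y)} and n = (h(y) - G) e^{-k(y)}.
Define φ as w_x - cn with w = αm; the Liénard equation says exactly that φ_x = 0. Hence c dx + φ dy
is closed and yields θ; the frame and m, n, w prescribe X_x and X_y, and the Poincaré lemma yields
the horizontal coordinates of X, then the vertical one (`exists_structureEqs`). Since ê₂ = (n X_x +
X_y) / (m √(1+α²)), the coefficients a, b encode n, m. For a given surface m e^{-E} and n + m e^{-E}
G depend on y alone, which recovers h and k; the sign of m is invisible to the exponential, whence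
|b| (`StructureEqs.exists_frameCoeffs`).

For rigidity, c, α, a, b determine m, n, w and φ, so the unit vectors X_x of two such surfaces turn
at the same rate and differ by a fixed rotation; what remains is a left translation
(`StructureEqs.exists_rigidMotion`).

Compatible coordinates come from flowing along e₁ from a transversal. Because H is constant, the
flow lines are explicit curves depending smoothly on their initial data (`exists_helix`), so a flow
known only to be continuous suffices (`IsCMCSurface.exists_compatibleChart`). -/

namespace Heis

/-! ### Partial derivatives of functions of two variables -/

/-- `F` has partial derivative `dF` in the first variable at `u`. -/
abbrev HasDx (F : ℝ × ℝ → ℝ) (dF : ℝ) (u : ℝ × ℝ) : Prop :=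
  HasDerivAt (fun t => F (t, u.2)) dF u.1

/-- `F` has partial derivative `dF` in the second variable at `u`. -/
abbrev HasDy (F : ℝ × ℝ → ℝ) (dF : ℝ) (u : ℝ × ℝ) : Prop :=
  HasDerivAt (fun t => F (u.1, t)) dF u.2

/-- The first partial derivative of `F`. -/
noncomputable def Dx (F : ℝ × ℝ → ℝ) (u : ℝ × ℝ) : ℝ := fderiv ℝ F u (1, 0)

/-- The second partial derivative of `F`. -/
noncomputable def Dy (F : ℝ × ℝ → ℝ) (u : ℝ × ℝ) : ℝ := fderiv ℝ F u (0, 1)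

theorem hasDerivAt_slice_fst {E : Type*} [NormedAddCommGroup E] [NormedSpace ℝ E]
    {F : ℝ × ℝ → E} {F' : ℝ × ℝ →L[ℝ] E} {u : ℝ × ℝ} (h : HasFDerivAt F F' u) :
    HasDerivAt (fun t => F (t, u.2)) (F' (1, 0)) u.1 :=
  HasFDerivAt.comp_hasDerivAt (f := fun t : ℝ => (t, u.2)) (l := F) u.1 h
    ((hasDerivAt_id u.1).prodMk (hasDerivAt_const u.1 u.2))

theorem hasDerivAt_slice_snd {E : Type*} [NormedAddCommGroup E] [NormedSpace ℝ E]
    {F : ℝ × ℝ → E} {F' : ℝ × ℝ →L[ℝ] E} {u : ℝ × ℝ} (h : HasFDerivAt F F' u) :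
    HasDerivAt (fun t => F (u.1, t)) (F' (0, 1)) u.2 :=
  HasFDerivAt.comp_hasDerivAt (f := fun t : ℝ => (u.1, t)) (l := F) u.2 h
    ((hasDerivAt_const u.2 u.1).prodMk (hasDerivAt_id u.2))

theorem clm_prod_apply {E : Type*} [NormedAddCommGroup E] [NormedSpace ℝ E]
    (A : ℝ × ℝ →L[ℝ] E) (v : ℝ × ℝ) : A v = v.1 • A (1, 0) + v.2 • A (0, 1) := by
  rw [← map_smul, ← map_smul, ← map_add]
  simp

theorem clm_prod_ext {E : Type*} [NormedAddCommGroup E] [NormedSpace ℝ E]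
    {A B : ℝ × ℝ →L[ℝ] E} (h1 : A (1, 0) = B (1, 0)) (h2 : A (0, 1) = B (0, 1)) : A = B := by
  ext <;> simp [h1, h2]

section Smooth

variable {U : Set (ℝ × ℝ)} {F G : ℝ × ℝ → ℝ} {u : ℝ × ℝ}

theorem contDiffOn_fderiv_apply {E : Type*} [NormedAddCommGroup E] [NormedSpace ℝ E]
    {F : ℝ × ℝ → E} (hU : IsOpen U) (hF : ContDiffOn ℝ ∞ F U) (v : ℝ × ℝ) :
    ContDiffOn ℝ ∞ (fun u => fderiv ℝ F u v) U :=
  (hF.fderiv_of_isOpen hU (m := ∞) (by simp)).clm_apply contDiffOn_const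

theorem contDiffOn_Dx (hU : IsOpen U) (hF : ContDiffOn ℝ ∞ F U) : ContDiffOn ℝ ∞ (Dx F) U :=
  contDiffOn_fderiv_apply hU hF _

theorem contDiffOn_Dy (hU : IsOpen U) (hF : ContDiffOn ℝ ∞ F U) : ContDiffOn ℝ ∞ (Dy F) U :=
  contDiffOn_fderiv_apply hU hF _

theorem hasFDerivAt_of_contDiffOn {E : Type*} [NormedAddCommGroup E] [NormedSpace ℝ E]
    {F : ℝ × ℝ → E} (hU : IsOpen U) (hF : ContDiffOn ℝ ∞ F U) (hu : u ∈ U) :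
    HasFDerivAt F (fderiv ℝ F u) u :=
  ((hF.contDiffAt (hU.mem_nhds hu)).differentiableAt (by simp)).hasFDerivAt

theorem hasDx (hU : IsOpen U) (hF : ContDiffOn ℝ ∞ F U) (hu : u ∈ U) : HasDx F (Dx F u) u :=
  hasDerivAt_slice_fst (hasFDerivAt_of_contDiffOn hU hF hu)

theorem hasDy (hU : IsOpen U) (hF : ContDiffOn ℝ ∞ F U) (hu : u ∈ U) : HasDy F (Dy F u) u :=
  hasDerivAt_slice_snd (hasFDerivAt_of_contDiffOn hU hF hu)

theorem Dx_Dy_comm (hU : IsOpen U) (hF : ContDiffOn ℝ ∞ F U) (hu : u ∈ U) :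
    Dy (Dx F) u = Dx (Dy F) u := by
  have hc := hF.contDiffAt (hU.mem_nhds hu)
  have hs : IsSymmSndFDerivAt ℝ F u := hc.isSymmSndFDerivAt (by
    rw [minSmoothness_of_isRCLikeNormedField]; exact WithTop.coe_le_coe.2 le_top)
  have hd : DifferentiableAt ℝ (fderiv ℝ F) u :=
    (hc.fderiv_right (m := ∞) (by simp)).differentiableAt (by simp)
  have key (v w : ℝ × ℝ) : fderiv ℝ (fun u => fderiv ℝ F u v) u w
      = fderiv ℝ (fderiv ℝ F) u w v := by
    rw [fderiv_clm_apply hd (differentiableAt_const v)]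
    simp
  exact (key _ _).trans ((hs _ _).trans (key _ _).symm)

theorem slice_fst_mem (hU : IsOpen U) (hu : u ∈ U) : ∀ᶠ t in 𝓝 u.1, (t, u.2) ∈ U :=
  (Continuous.prodMk_left u.2).continuousAt.eventually (hU.mem_nhds hu)

theorem slice_snd_mem (hU : IsOpen U) (hu : u ∈ U) : ∀ᶠ t in 𝓝 u.2, (u.1, t) ∈ U :=
  (Continuous.prodMk_right u.1).continuousAt.eventually (hU.mem_nhds hu)

theorem HasDx.congr {F' : ℝ} (h : HasDx F F' u) (hU : IsOpen U) (hu : u ∈ U)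
    (hFG : ∀ v ∈ U, G v = F v) : HasDx G F' u :=
  HasDerivAt.congr_of_eventuallyEq h ((slice_fst_mem hU hu).mono fun _ ht => hFG _ ht)

theorem HasDy.congr {F' : ℝ} (h : HasDy F F' u) (hU : IsOpen U) (hu : u ∈ U)
    (hFG : ∀ v ∈ U, G v = F v) : HasDy G F' u :=
  HasDerivAt.congr_of_eventuallyEq h ((slice_snd_mem hU hu).mono fun _ ht => hFG _ ht)

theorem fderiv_eq_zero_of_slices (hU : IsOpen U) (hF : ContDiffOn ℝ ∞ F U) (hu : u ∈ U)
    (hx : HasDx F 0 u) (hy : HasDy F 0 u) : fderiv ℝ F u = 0 :=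
  clm_prod_ext (((hasDx hU hF hu).unique hx).trans (by simp))
    (((hasDy hU hF hu).unique hy).trans (by simp))

/-- A function with vanishing partial derivatives on a connected open set is constant. -/
theorem exists_const_of_slices (hU : IsOpen U) (hc : IsPreconnected U)
    (hF : ContDiffOn ℝ ∞ F U) (hx : ∀ u ∈ U, HasDx F 0 u) (hy : ∀ u ∈ U, HasDy F 0 u) :
    ∃ a, ∀ u ∈ U, F u = a :=
  hU.exists_is_const_of_fderiv_eq_zero hc (hF.differentiableOn (by simp))
    fun u hu => fderiv_eq_zero_of_slices hU hF hu (hx u hu) (hy u hu)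

/-- The Poincaré lemma on a convex open set of the plane. -/
theorem exists_primitive (hU : IsOpen U) (hc : Convex ℝ U) {P Q D : ℝ × ℝ → ℝ}
    (hP : ContDiffOn ℝ ∞ P U) (hQ : ContDiffOn ℝ ∞ Q U)
    (hPy : ∀ u ∈ U, HasDy P (D u) u) (hQx : ∀ u ∈ U, HasDx Q (D u) u) :
    ∃ F : ℝ × ℝ → ℝ, ContDiffOn ℝ ∞ F U ∧ ∀ u ∈ U, Dx F u = P u ∧ Dy F u = Q u := by
  let form : ℝ × ℝ → (ℝ × ℝ →L[ℝ] ℝ) := fun u =>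
    P u • ContinuousLinearMap.fst ℝ ℝ ℝ + Q u • ContinuousLinearMap.snd ℝ ℝ ℝ
  have hform : ContDiffOn ℝ ∞ form U :=
    (hP.smul contDiffOn_const).add (hQ.smul contDiffOn_const)
  obtain ⟨F, hF⟩ := hc.exists_forall_hasFDerivAt_of_fderiv_symmetric hU
    (hform.differentiableOn (by simp)) (by
      intro u hu v w
      have hd := ((hasFDerivAt_of_contDiffOn hU hP hu).smul_const
        (ContinuousLinearMap.fst ℝ ℝ ℝ)).add ((hasFDerivAt_of_contDiffOn hU hQ hu).smul_const
        (ContinuousLinearMap.snd ℝ ℝ ℝ))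
      have hd' : fderiv ℝ form u = _ := hd.fderiv
      have hsym : fderiv ℝ P u (0, 1) = fderiv ℝ Q u (1, 0) :=
        ((hasDy hU hP hu).unique (hPy u hu)).trans ((hasDx hU hQ hu).unique (hQx u hu)).symm
      rw [hd']
      simp only [add_apply, ContinuousLinearMap.smulRight_apply,
        smul_apply, ContinuousLinearMap.coe_fst', ContinuousLinearMap.coe_snd',
        smul_eq_mul]
      rw [clm_prod_apply (fderiv ℝ P u) v, clm_prod_apply (fderiv ℝ P u) w,
        clm_prod_apply (fderiv ℝ Q u) v, clm_prod_apply (fderiv ℝ Q u) w, hsym]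
      simp only [smul_eq_mul]
      ring)
  refine ⟨F, ?_, fun u hu => ?_⟩
  · rw [contDiffOn_infty_iff_fderiv_of_isOpen hU]
    exact ⟨fun u hu => (hF u hu).differentiableAt.differentiableWithinAt,
      hform.congr fun u hu => (hF u hu).fderiv⟩
  · simp [Dx, Dy, (hF u hu).fderiv, form]

end Smooth

/-! ### Charts of surfaces -/

section Charts

variable {S : Set H1} {U : Set (ℝ × ℝ)} {X : ℝ × ℝ → H1} {u₀ : ℝ × ℝ}

/-- An immersion has, near each point, a smooth left inverse. -/
theorem exists_smooth_leftInverse (hX : ContDiffAt ℝ ∞ X u₀)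
    (hinj : Function.Injective (fderiv ℝ X u₀)) :
    ∃ L : H1 → ℝ × ℝ, ContDiffAt ℝ ∞ L (X u₀) ∧ ∀ᶠ u in 𝓝 u₀, L (X u) = u := by
  obtain ⟨l, hl⟩ := LinearMap.exists_leftInverse_of_injective
    (fderiv ℝ X u₀ : ℝ × ℝ →ₗ[ℝ] H1) (LinearMap.ker_eq_bot.2 hinj)
  let l' : H1 →L[ℝ] ℝ × ℝ := LinearMap.toContinuousLinearMap l
  have hf : ContDiffAt ℝ ∞ (fun u => l' (X u)) u₀ := l'.contDiff.contDiffAt.comp u₀ hX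
  -- Composing with a linear left inverse of the differential gives a map of the plane with
  -- derivative the identity, to which the inverse function theorem applies.
  have hd : HasFDerivAt (fun u => l' (X u))
      ((ContinuousLinearEquiv.refl ℝ (ℝ × ℝ) : (ℝ × ℝ) ≃L[ℝ] ℝ × ℝ) : ℝ × ℝ →L[ℝ] ℝ × ℝ) u₀ := by
    have h := l'.hasFDerivAt.comp u₀ (hX.differentiableAt (by simp)).hasFDerivAt
    refine h.congr_fderiv ?_
    exact ContinuousLinearMap.ext fun v => LinearMap.congr_fun hl v
  have hs := hf.hasStrictFDerivAt' hd (by simp)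
  refine ⟨fun P => hf.localInverse hd (by simp) (l' P), ?_, hs.eventually_left_inverse⟩
  exact (hf.to_localInverse hd (by simp)).comp (X u₀) l'.contDiff.contDiffAt

theorem IsSmoothEmbedding.contDiffAt (hX : IsSmoothEmbedding U X) (hu : u₀ ∈ U) :
    ContDiffAt ℝ ∞ X u₀ :=
  hX.smooth.contDiffAt (hX.isOpen.mem_nhds hu)

theorem IsSmoothEmbedding.hasFDerivAt (hX : IsSmoothEmbedding U X) (hu : u₀ ∈ U) :
    HasFDerivAt X (fderiv ℝ X u₀) u₀ :=
  hasFDerivAt_of_contDiffOn hX.isOpen hX.smooth hu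

/-- The image of an open set under an embedding is open in the image. -/
theorem IsSmoothEmbedding.exists_open_image (hX : IsSmoothEmbedding U X) {N : Set (ℝ × ℝ)}
    (hN : IsOpen N) (hNU : N ⊆ U) : ∃ O : Set H1, IsOpen O ∧ X '' N = X '' U ∩ O := by
  obtain ⟨O, hO, hON⟩ := hX.embedding.isInducing.isOpen_iff.1
    (hN.preimage (continuous_subtype_val (p := (· ∈ U))))
  have key (u : ℝ × ℝ) (hu : u ∈ U) : X u ∈ O ↔ u ∈ N :=
    Set.ext_iff.1 hON ⟨u, hu⟩
  refine ⟨O, hO, ?_⟩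
  ext P
  constructor
  · rintro ⟨u, hu, rfl⟩
    exact ⟨⟨u, hNU hu, rfl⟩, (key u (hNU hu)).2 hu⟩
  · rintro ⟨⟨u, hu, rfl⟩, hO⟩
    exact ⟨u, (key u hu).1 hO, rfl⟩

theorem IsSmoothEmbedding.injOn (hX : IsSmoothEmbedding U X) : InjOn X U :=
  injOn_iff_injective.2 hX.embedding.injective

theorem IsChart.exists_open_image (hX : IsChart S U X) {N : Set (ℝ × ℝ)}
    (hN : IsOpen N) (hNU : N ⊆ U) : ∃ O : Set H1, IsOpen O ∧ X '' N = S ∩ O := by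
  obtain ⟨O, hO, h⟩ := hX.isSmoothEmbedding.exists_open_image hN hNU
  obtain ⟨O', hO', h'⟩ := hX.image_eq
  exact ⟨O' ∩ O, hO'.inter hO, by rw [h, h', inter_assoc]⟩

theorem IsChart.mem (hX : IsChart S U X) (hu : u₀ ∈ U) : X u₀ ∈ S := by
  obtain ⟨O, -, h⟩ := hX.image_eq
  exact (h.subset ⟨u₀, hu, rfl⟩).1

theorem IsSmoothEmbedding.isChart_image (hX : IsSmoothEmbedding U X) : IsChart (X '' U) U X :=
  ⟨hX, univ, isOpen_univ, by simp⟩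

theorem IsSmoothEmbedding.isSurface_image (hX : IsSmoothEmbedding U X) : IsSurface (X '' U) :=
  fun _ hp => ⟨U, X, hX.isChart_image, hp⟩

/-- The coordinates of a chart extend locally to a smooth function on the ambient space. -/
theorem IsChart.exists_coordinates (hX : IsChart S U X) (hu : u₀ ∈ U) :
    ∃ L : H1 → ℝ × ℝ, ContDiffAt ℝ ∞ L (X u₀) ∧ L (X u₀) = u₀ ∧
      (∀ᶠ u in 𝓝 u₀, L (X u) = u) ∧ ∀ᶠ P in 𝓝[S] (X u₀), L P ∈ U ∧ X (L P) = P := by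
  have hE := hX.isSmoothEmbedding
  obtain ⟨L, hL, hLX⟩ := exists_smooth_leftInverse (hE.contDiffAt hu) (hE.immersion u₀ hu)
  -- `L` inverts `X` only near `u₀`. On such a neighbourhood `N` the image is relatively open in
  -- `S`, so every point of `S` near `X u₀` comes from `N`.
  obtain ⟨N, hN, hNo, huN⟩ := eventually_nhds_iff.1 (hLX.and (hE.isOpen.mem_nhds hu))
  obtain ⟨O, hO, hNO⟩ := hX.exists_open_image hNo fun u h => (hN u h).2
  refine ⟨L, hL, hLX.self_of_nhds, hLX, ?_⟩
  have hmem : X u₀ ∈ O := (hNO.subset ⟨u₀, huN, rfl⟩).2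
  filter_upwards [mem_nhdsWithin_of_mem_nhds (hO.mem_nhds hmem), self_mem_nhdsWithin] with P hP hPS
  obtain ⟨u, huN, rfl⟩ := hNO.superset ⟨hPS, hP⟩
  rw [(hN u huN).1]
  exact ⟨(hN u huN).2, rfl⟩

/-- A smooth curve in a surface is smooth in the coordinates of a chart. -/
theorem IsChart.exists_curve (hX : IsChart S U X) (hu : u₀ ∈ U) {v : H1} {γ : ℝ → H1}
    (hγ : IsCurveIn S (X u₀) v γ) :
    ∃ β : ℝ → ℝ × ℝ, DifferentiableAt ℝ β 0 ∧ β 0 = u₀ ∧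
      (∀ᶠ t in 𝓝 (0 : ℝ), β t ∈ U ∧ γ t = X (β t)) ∧ fderiv ℝ X u₀ (deriv β 0) = v := by
  obtain ⟨L, hL, hL0, -, hLS⟩ := hX.exists_coordinates hu
  have hβ : DifferentiableAt ℝ (fun t => L (γ t)) 0 := by
    refine DifferentiableAt.comp (0 : ℝ) ?_ (hγ.smooth.differentiableAt (by simp))
    rw [hγ.pos]
    exact hL.differentiableAt (by simp)
  have hlim : Tendsto γ (𝓝 0) (𝓝[S] (X u₀)) := by
    refine tendsto_nhdsWithin_iff.2 ⟨?_, hγ.mem⟩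
    rw [← hγ.pos]
    exact hγ.smooth.continuousAt
  have hev := hlim.eventually hLS
  refine ⟨fun t => L (γ t), hβ, by simp [hγ.pos, hL0], hev.mono fun t ht => ⟨ht.1, ht.2.symm⟩, ?_⟩
  have h0 : L (γ 0) = u₀ := by rw [hγ.pos, hL0]
  have hF := hX.isSmoothEmbedding.hasFDerivAt hu
  rw [← h0] at hF
  have h1 := hF.comp_hasDerivAt (0 : ℝ) hβ.hasDerivAt
  have h2 : HasDerivAt γ (fderiv ℝ X (L (γ 0)) (deriv (fun t => L (γ t)) 0)) 0 :=
    h1.congr_of_eventuallyEq (hev.mono fun t ht => ht.2.symm)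
  rw [h0] at h2
  rw [← hγ.vel, h2.deriv]

/-- The image under a chart of a straight line in the plane is a curve in the surface. -/
theorem IsChart.isCurveIn_line (hX : IsChart S U X) (hu : u₀ ∈ U) (w : ℝ × ℝ) :
    IsCurveIn S (X u₀) (fderiv ℝ X u₀ w) (fun t => X (u₀ + t • w)) := by
  have hE := hX.isSmoothEmbedding
  have hline : ContDiff ℝ ∞ (fun t : ℝ => u₀ + t • w) :=
    contDiff_const.add (contDiff_id.smul contDiff_const)
  have h0 : u₀ + (0 : ℝ) • w = u₀ := by simp
  have hd : HasDerivAt (fun t : ℝ => u₀ + t • w) w 0 := by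
    simpa using ((hasDerivAt_id (0 : ℝ)).smul_const w).const_add u₀
  refine ⟨?_, ?_, by simp, ?_⟩
  · refine ContDiffAt.comp (0 : ℝ) ?_ hline.contDiffAt
    rw [h0]
    exact hE.contDiffAt hu
  · have : ∀ᶠ t in 𝓝 (0 : ℝ), u₀ + t • w ∈ U :=
      hline.continuous.continuousAt.eventually (hE.isOpen.mem_nhds (by simpa using hu))
    exact this.mono fun t ht => hX.mem ht
  · have hF := hE.hasFDerivAt hu
    rw [← h0] at hF
    have := hF.comp_hasDerivAt (0 : ℝ) hd
    rw [h0] at this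
    exact this.deriv

/-- Curves in the surface pull back to differentiable curves in the chart, and straight lines in the
chart push forward. This turns the definition by curves into linear algebra. -/
theorem IsChart.tangentPlane_eq (hX : IsChart S U X) (hu : u₀ ∈ U) :
    tangentPlane S (X u₀) = range (fderiv ℝ X u₀) := by
  ext v
  constructor
  · rintro ⟨γ, hγ⟩
    obtain ⟨β, -, -, -, h⟩ := hX.exists_curve hu hγ
    exact ⟨_, h⟩
  · rintro ⟨w, rfl⟩
    exact ⟨_, hX.isCurveIn_line hu w⟩

/-- An immersion at a point is an embedding of a neighbourhood. -/
theorem exists_isSmoothEmbedding (hU : IsOpen U) (hX : ContDiffOn ℝ ∞ X U) (hu : u₀ ∈ U)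
    (hinj : Function.Injective (fderiv ℝ X u₀)) :
    ∃ W ⊆ U, u₀ ∈ W ∧ IsSmoothEmbedding W X := by
  have hc := hX.contDiffAt (hU.mem_nhds hu)
  obtain ⟨L, hL, hLX⟩ := exists_smooth_leftInverse hc hinj
  -- The order is lowered to 1 because finite-order smoothness at a point spreads to a
  -- neighbourhood, whereas for `∞` the neighbourhood may shrink with the order.
  have hLc : ∀ᶠ P in 𝓝 (X u₀), ContinuousAt L P :=
    ((hL.of_le (m := 1) (by simp)).eventually (by simp)).mono
      fun P hP => hP.continuousAt
  have hI : ∀ᶠ u in 𝓝 u₀, Function.Injective (fderiv ℝ X u) :=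
    (hc.fderiv_right (m := ∞) (by simp)).continuousAt.eventually
      (ContinuousLinearMap.isOpen_injective.mem_nhds hinj)
  obtain ⟨W, hW, hWo, huW⟩ := eventually_nhds_iff.1
    (((hLX.and hI).and (hc.continuousAt.eventually hLc)).and (hU.mem_nhds hu))
  have hWU : W ⊆ U := fun u h => (hW u h).2
  refine ⟨W, hWU, huW, hWo, hX.mono hWU, fun u h => (hW u h).1.1.2, ?_, ?_⟩
  -- A left inverse that is continuous at the points of the image makes `X` inducing, not merely
  -- injective.
  · refine isInducing_iff_nhds.2 fun u => le_antisymm ?_ ?_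
    · rw [← tendsto_iff_comap]
      exact ((hX.mono hWU).continuousOn.domRestrict).continuousAt
    · have h1 : Tendsto (fun w : W => L (X w)) (comap (W.domRestrict X) (𝓝 (X u))) (𝓝 u.1) := by
        have := (hW u u.2).1.2
        rw [ContinuousAt, (hW u u.2).1.1.1] at this
        exact this.comp tendsto_comap
      rw [nhds_subtype_eq_comap, ← tendsto_iff_comap]
      exact h1.congr fun w => (hW w w.2).1.1.1
  · intro u v h
    have h' : X u = X v := h
    exact Subtype.ext (by rw [← (hW u u.2).1.1.1, ← (hW v v.2).1.1.1, h'])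

end Charts

/-! ### Pointwise identities -/

theorem contactForm_apply (P v : H1) :
    contactForm P v = v.2.2 + P.1 * v.2.1 - P.2.1 * v.1 := rfl

theorem cxJ_fst (P v : H1) : (cxJ P v).1 = -v.2.1 := by simp [cxJ, frame1, frame2]

theorem cxJ_snd_fst (P v : H1) : (cxJ P v).2.1 = v.1 := by simp [cxJ, frame1, frame2]

theorem contactForm_cxJ (P v : H1) : contactForm P (cxJ P v) = 0 := by
  simp [contactForm_apply, cxJ, frame1, frame2]; ring

theorem contactForm_reeb (P : H1) : contactForm P (reeb P) = 1 := by
  simp [contactForm_apply, reeb]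

/-- Vectors are determined by their horizontal components and the contact form. -/
theorem ext_contactForm {P v w : H1} (h1 : v.1 = w.1) (h2 : v.2.1 = w.2.1)
    (h3 : contactForm P v = contactForm P w) : v = w := by
  rw [frame_expansion P v, frame_expansion P w, h1, h2, h3]

theorem adaptedMetric_self_of_horizontal {P v : H1} (h : contactForm P v = 0) :
    adaptedMetric P v v = v.1 ^ 2 + v.2.1 ^ 2 := by
  simp [adaptedMetric, h]; ring

/-- If `v` is a horizontal unit vector and `w` is transverse to the contact plane, then
`α J v + T`, where `α` is determined by `v` and `w`, is a combination of `v` and `w`. -/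
theorem alpha_combination {P v w : H1} {α : ℝ} (hv : contactForm P v = 0)
    (hu : v.1 ^ 2 + v.2.1 ^ 2 = 1) (hw : contactForm P w ≠ 0)
    (hα : α * contactForm P w = v.1 * w.2.1 - v.2.1 * w.1) :
    α • cxJ P v + reeb P =
      (-(v.1 * w.1 + v.2.1 * w.2.1) / contactForm P w) • v + (1 / contactForm P w) • w := by
  have hα' : α = (v.1 * w.2.1 - v.2.1 * w.1) / contactForm P w := by
    rw [← hα]; field_simp
  apply ext_contactForm (P := P)
  · simp only [Prod.fst_add, Prod.smul_fst, cxJ_fst, smul_eq_mul, reeb, hα']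
    field_simp
    linear_combination w.1 * hu
  · simp only [Prod.fst_add, Prod.snd_add, Prod.smul_fst, Prod.smul_snd, cxJ_snd_fst, smul_eq_mul,
      reeb, hα']
    field_simp
    linear_combination w.2.1 * hu
  · simp only [map_add, map_smul, contactForm_cxJ, contactForm_reeb, hv, smul_eq_mul]
    field_simp
    ring

/-- Converse of `alpha_combination`: apply Θ, and take the horizontal components of the equation
along `J v` and along `v`. -/
theorem alpha_eq_of_combination {P v w : H1} {α a b : ℝ} (hv : contactForm P v = 0)
    (hu : v.1 ^ 2 + v.2.1 ^ 2 = 1) (h : α • cxJ P v + reeb P = a • v + b • w) :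
    b * contactForm P w = 1 ∧ α * contactForm P w = v.1 * w.2.1 - v.2.1 * w.1 ∧
      a = -(b * (v.1 * w.1 + v.2.1 * w.2.1)) := by
  have h1 := congrArg (fun x : H1 => x.1) h
  have h2 := congrArg (fun x : H1 => x.2.1) h
  have h3 := congrArg (contactForm P) h
  simp only [Prod.fst_add, Prod.snd_add, Prod.smul_fst, Prod.smul_snd, cxJ_fst, cxJ_snd_fst,
    smul_eq_mul, reeb, add_zero] at h1 h2
  simp only [map_add, map_smul, contactForm_cxJ, contactForm_reeb, hv, smul_eq_mul, mul_zero,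
    zero_add] at h3
  refine ⟨h3.symm, ?_, ?_⟩
  · linear_combination (-(α * contactForm P w)) * hu + (contactForm P w) * v.1 * h2
      - (contactForm P w) * v.2.1 * h1 - (v.1 * w.2.1 - v.2.1 * w.1) * h3
  · linear_combination (-a) * hu - v.1 * h1 - v.2.1 * h2

theorem finrank_contactPlane (P : H1) : Module.finrank ℝ (contactPlane P) = 2 := by
  have h0 : contactForm P ≠ 0 := fun h => by
    have := contactForm_reeb P
    rw [h] at this
    simp at this
  have := Module.Dual.finrank_ker_add_one_of_ne_zero (f := contactForm P) h0
  have h3 : Module.finrank ℝ H1 = 3 := by simp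
  rw [h3] at this
  exact Nat.succ_injective this

/-! ### The structure equations -/

/-- The equations satisfied by a parametrization by compatible coordinates of a surface without
singular points that has p-mean curvature `c` and α-function `α`. -/
structure StructureEqs (c : ℝ) (α : ℝ × ℝ → ℝ) (U : Set (ℝ × ℝ)) (X : ℝ × ℝ → H1) : Prop where
  isOpen : IsOpen U
  smooth : ContDiffOn ℝ ∞ X U
  horizontal : ∀ u ∈ U, contactForm (X u) (dX X u) = 0
  unit : ∀ u ∈ U, (dX X u).1 ^ 2 + (dX X u).2.1 ^ 2 = 1
  curvature_fst : ∀ u ∈ U, HasDx (fun v => (dX X v).1) (-(c * (dX X u).2.1)) u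
  curvature_snd : ∀ u ∈ U, HasDx (fun v => (dX X v).2.1) (c * (dX X u).1) u
  transverse : ∀ u ∈ U, contactForm (X u) (dY X u) ≠ 0
  alpha : ∀ u ∈ U, α u * contactForm (X u) (dY X u) =
    (dX X u).1 * (dY X u).2.1 - (dX X u).2.1 * (dY X u).1

section Derive

variable {c : ℝ} {S : Set H1} {e : H1 → H1} {U : Set (ℝ × ℝ)} {X : ℝ × ℝ → H1} {u : ℝ × ℝ}

theorem fderiv_eq_combination (X : ℝ × ℝ → H1) (u w : ℝ × ℝ) :
    fderiv ℝ X u w = w.1 • dX X u + w.2 • dY X u :=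
  clm_prod_apply _ _

theorem contDiffOn_dX (hU : IsOpen U) (hX : ContDiffOn ℝ ∞ X U) : ContDiffOn ℝ ∞ (dX X) U :=
  contDiffOn_fderiv_apply hU hX _

theorem contDiffOn_dY (hU : IsOpen U) (hX : ContDiffOn ℝ ∞ X U) : ContDiffOn ℝ ∞ (dY X) U :=
  contDiffOn_fderiv_apply hU hX _

/-- The equation `∇_{e₁} e₂ = -c e₁` in components, along a curve. -/
theorem covDerivAlong_components {γ V : ℝ → H1} {t : ℝ} {w : H1}
    (h : covDerivAlong γ (fun t => cxJ (γ t) (V t)) t = w) :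
    -deriv (fun s => (V s).2.1) t = w.1 ∧ deriv (fun s => (V s).1) t = w.2.1 := by
  simp only [covDerivAlong, cxJ_fst, cxJ_snd_fst, contactForm_cxJ, deriv_const, zero_smul,
    add_zero, deriv.fun_neg, frame1, frame2] at h
  rw [← h]
  simp

theorem IsCompatibleChart.horizontal (hS : IsCMCSurface c S e) (hX : IsCompatibleChart S e U X)
    (hu : u ∈ U) : contactForm (X u) (dX X u) = 0 := by
  rw [hX.compatible u hu]
  exact hS.characteristic.horizontal _ (hX.isChart.mem hu)

theorem IsCompatibleChart.unit (hS : IsCMCSurface c S e) (hX : IsCompatibleChart S e U X)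
    (hu : u ∈ U) : (dX X u).1 ^ 2 + (dX X u).2.1 ^ 2 = 1 := by
  rw [← adaptedMetric_self_of_horizontal (IsCompatibleChart.horizontal hS hX hu),
    hX.compatible u hu]
  exact hS.characteristic.unit _ (hX.isChart.mem hu)

/-- The derivatives of the components of `e` in the direction of `e`, in a chart. -/
theorem IsChart.fderiv_field (hS : IsCMCSurface c S e) (hX : IsChart S U X) (hu : u ∈ U)
    {w : ℝ × ℝ} (hw : fderiv ℝ X u w = e (X u)) :
    fderiv ℝ (fun v => (e (X v)).1) u w = -(c * (e (X u)).2.1) ∧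
      fderiv ℝ (fun v => (e (X v)).2.1) u w = c * (e (X u)).1 := by
  have hE := hX.isSmoothEmbedding
  have he := hS.characteristic.smooth U X hX
  have hγ := hX.isCurveIn_line hu w
  rw [hw] at hγ
  have key := covDerivAlong_components (hS.curvature _ (hX.mem hu) _ hγ)
  have hline : HasDerivAt (fun t : ℝ => u + t • w) w 0 := by
    simpa using ((hasDerivAt_id (0 : ℝ)).smul_const w).const_add u
  have comp (F : ℝ × ℝ → ℝ) (hF : ContDiffOn ℝ ∞ F U) :
      deriv (fun t : ℝ => F (u + t • w)) 0 = fderiv ℝ F u w := by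
    have h := hasFDerivAt_of_contDiffOn hE.isOpen hF hu
    have h0 : u = u + (0 : ℝ) • w := by simp
    rw [h0] at h
    have := h.comp_hasDerivAt (0 : ℝ) hline
    rw [← h0] at this
    exact this.deriv
  rw [comp (fun v => (e (X v)).1) he.fst, comp (fun v => (e (X v)).2.1) he.snd.fst] at key
  simp only [Prod.smul_fst, Prod.smul_snd, smul_eq_mul] at key
  exact ⟨by linarith [key.2], by linarith [key.1]⟩

theorem IsCompatibleChart.curvature (hS : IsCMCSurface c S e) (hX : IsCompatibleChart S e U X)
    (hu : u ∈ U) : HasDx (fun v => (dX X v).1) (-(c * (dX X u).2.1)) u ∧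
      HasDx (fun v => (dX X v).2.1) (c * (dX X u).1) u := by
  have hE := hX.isChart.isSmoothEmbedding
  have he := hS.characteristic.smooth U X hX.isChart
  have key := hX.isChart.fderiv_field hS hu (hX.compatible u hu)
  rw [← hX.compatible u hu] at key
  have h1 : HasDx (fun v => (e (X v)).1) (-(c * (dX X u).2.1)) u :=
    (hasDx hE.isOpen he.fst hu).congr_deriv key.1
  have h2 : HasDx (fun v => (e (X v)).2.1) (c * (dX X u).1) u :=
    (hasDx hE.isOpen he.snd.fst hu).congr_deriv key.2
  exact ⟨HasDx.congr h1 hE.isOpen hu fun v hv => by rw [hX.compatible v hv],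
    HasDx.congr h2 hE.isOpen hu fun v hv => by rw [hX.compatible v hv]⟩

/-- If Θ vanished on both coordinate vectors, the two-dimensional tangent plane would lie in the
contact plane and so coincide with it. -/
theorem IsChart.transverse (hX : IsChart S U X) (hu : u ∈ U) (hs : ¬ IsSingularPoint S (X u))
    (hh : contactForm (X u) (dX X u) = 0) : contactForm (X u) (dY X u) ≠ 0 := by
  intro h0
  apply hs
  rw [IsSingularPoint, hX.tangentPlane_eq hu]
  have hle : LinearMap.range (fderiv ℝ X u : ℝ × ℝ →ₗ[ℝ] H1) ≤ contactPlane (X u) := by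
    rintro _ ⟨w, rfl⟩
    change contactForm (X u) (fderiv ℝ X u w) = 0
    rw [fderiv_eq_combination, map_add, map_smul, map_smul, hh, h0]
    simp
  have hrank : Module.finrank ℝ (LinearMap.range (fderiv ℝ X u : ℝ × ℝ →ₗ[ℝ] H1))
      = Module.finrank ℝ (contactPlane (X u)) := by
    rw [finrank_contactPlane,
      LinearMap.finrank_range_of_inj (hX.isSmoothEmbedding.immersion u hu)]
    simp
  rw [← Submodule.eq_of_le_of_finrank_eq hle hrank]
  rfl

theorem IsCompatibleChart.structureEqs (hS : IsCMCSurface c S e) (hX : IsCompatibleChart S e U X)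
    {A : H1 → ℝ} (hA : IsAlphaFunction S e A) : StructureEqs c (fun u => A (X u)) U X := by
  have hE := hX.isChart.isSmoothEmbedding
  refine ⟨hE.isOpen, hE.smooth, fun u hu => IsCompatibleChart.horizontal hS hX hu,
    fun u hu => IsCompatibleChart.unit hS hX hu,
    fun u hu => (IsCompatibleChart.curvature hS hX hu).1,
    fun u hu => (IsCompatibleChart.curvature hS hX hu).2, fun u hu => hX.isChart.transverse hu
      (hS.no_singular _ (hX.isChart.mem hu)) (IsCompatibleChart.horizontal hS hX hu), ?_⟩
  intro u hu
  have h := hA _ (hX.isChart.mem hu)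
  rw [hX.isChart.tangentPlane_eq hu, ← hX.compatible u hu] at h
  obtain ⟨w, hw⟩ := h
  rw [fderiv_eq_combination] at hw
  exact (alpha_eq_of_combination (IsCompatibleChart.horizontal hS hX hu)
    (IsCompatibleChart.unit hS hX hu) hw.symm).2.1

theorem IsRealization.structureEqs {α : ℝ × ℝ → ℝ} (h : IsRealization c α U X) :
    StructureEqs c α U X := by
  obtain ⟨-, e, A, hS, hX, hA, hα⟩ := h
  have h := IsCompatibleChart.structureEqs hS hX hA
  exact { h with alpha := fun u hu => by rw [← hα u hu]; exact h.alpha u hu }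

/-- At each point in a compatible chart there is a value of the α-function. -/
theorem IsCompatibleChart.exists_alpha (hS : IsCMCSurface c S e) (hX : IsCompatibleChart S e U X)
    (hu : u ∈ U) : ∃ a : ℝ, a • cxJ (X u) (e (X u)) + reeb (X u) ∈ tangentPlane S (X u) := by
  have hh := IsCompatibleChart.horizontal hS hX hu
  have ht := hX.isChart.transverse hu (hS.no_singular _ (hX.isChart.mem hu)) hh
  refine ⟨((dX X u).1 * (dY X u).2.1 - (dX X u).2.1 * (dY X u).1) / contactForm (X u) (dY X u), ?_⟩
  rw [hX.isChart.tangentPlane_eq hu, ← hX.compatible u hu,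
    alpha_combination hh (IsCompatibleChart.unit hS hX hu) ht (by field_simp)]
  exact ⟨(_, _), fderiv_eq_combination X u _⟩

end Derive

/-! ### Consequences of the structure equations -/

/-- `Θ(∂/∂y)`. -/
noncomputable def contactY (X : ℝ × ℝ → H1) (u : ℝ × ℝ) : ℝ := contactForm (X u) (dY X u)

/-- `-⟨∂/∂x, ∂/∂y⟩`, when `∂/∂x` is horizontal. -/
noncomputable def shiftY (X : ℝ × ℝ → H1) (u : ℝ × ℝ) : ℝ :=
  -((dX X u).1 * (dY X u).1 + (dX X u).2.1 * (dY X u).2.1)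

/-- `⟨J ∂/∂x, ∂/∂y⟩`, when `∂/∂x` is horizontal. -/
noncomputable def normalY (X : ℝ × ℝ → H1) (u : ℝ × ℝ) : ℝ :=
  (dX X u).1 * (dY X u).2.1 - (dX X u).2.1 * (dY X u).1

/-- The derivative in `y` of the angle of the unit vector `∂/∂x`. -/
noncomputable def angleY (X : ℝ × ℝ → H1) (u : ℝ × ℝ) : ℝ :=
  (dX X u).1 * Dy (fun v => (dX X v).2.1) u - (dX X u).2.1 * Dy (fun v => (dX X v).1) u

section Mixed

variable {U : Set (ℝ × ℝ)} {X : ℝ × ℝ → H1} {u : ℝ × ℝ}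

theorem hasFDerivAt_clm_comp (hU : IsOpen U) (hX : ContDiffOn ℝ ∞ X U) (hu : u ∈ U)
    (ℓ : H1 →L[ℝ] ℝ) : HasFDerivAt (fun v => ℓ (X v)) (ℓ ∘L fderiv ℝ X u) u :=
  ℓ.hasFDerivAt.comp u (hasFDerivAt_of_contDiffOn hU hX hu)

/-- The mixed second derivatives of a component of `X`. -/
theorem hasDx_dY_component (hU : IsOpen U) (hX : ContDiffOn ℝ ∞ X U) (hu : u ∈ U)
    (ℓ : H1 →L[ℝ] ℝ) : HasDx (fun v => ℓ (dY X v)) (Dy (fun v => ℓ (dX X v)) u) u := by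
  have hF : ContDiffOn ℝ ∞ (fun v => ℓ (X v)) U := ℓ.contDiff.comp_contDiffOn hX
  have ex (v : ℝ × ℝ) (hv : v ∈ U) : ℓ (dX X v) = Dx (fun v => ℓ (X v)) v := by
    rw [Dx, (hasFDerivAt_clm_comp hU hX hv ℓ).fderiv]; rfl
  have ey (v : ℝ × ℝ) (hv : v ∈ U) : ℓ (dY X v) = Dy (fun v => ℓ (X v)) v := by
    rw [Dy, (hasFDerivAt_clm_comp hU hX hv ℓ).fderiv]; rfl
  have h1 := HasDx.congr (hasDx hU (contDiffOn_Dy hU hF) hu) hU hu ey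
  have h2 := HasDy.congr (hasDy hU (contDiffOn_Dx hU hF) hu) hU hu ex
  have h3 := hasDy hU (ℓ.contDiff.comp_contDiffOn (contDiffOn_dX hU hX)) hu
  refine h1.congr_deriv ?_
  rw [← Dx_Dy_comm hU hF hu]
  exact h2.unique h3

theorem hasDx_component (hU : IsOpen U) (hX : ContDiffOn ℝ ∞ X U) (hu : u ∈ U)
    (ℓ : H1 →L[ℝ] ℝ) : HasDx (fun v => ℓ (X v)) (ℓ (dX X u)) u :=
  hasDerivAt_slice_fst (hasFDerivAt_clm_comp hU hX hu ℓ)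

theorem hasDy_component (hU : IsOpen U) (hX : ContDiffOn ℝ ∞ X U) (hu : u ∈ U)
    (ℓ : H1 →L[ℝ] ℝ) : HasDy (fun v => ℓ (X v)) (ℓ (dY X u)) u :=
  hasDerivAt_slice_snd (hasFDerivAt_clm_comp hU hX hu ℓ)

end Mixed

/-- The first coordinate on `H1`. -/
def coordX : H1 →L[ℝ] ℝ := ContinuousLinearMap.fst ℝ ℝ (ℝ × ℝ)

/-- The second coordinate on `H1`. -/
def coordY : H1 →L[ℝ] ℝ := ContinuousLinearMap.fst ℝ ℝ ℝ ∘L ContinuousLinearMap.snd ℝ ℝ (ℝ × ℝ)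

/-- The third coordinate on `H1`. -/
def coordZ : H1 →L[ℝ] ℝ := ContinuousLinearMap.snd ℝ ℝ ℝ ∘L ContinuousLinearMap.snd ℝ ℝ (ℝ × ℝ)

namespace StructureEqs

variable {c : ℝ} {α : ℝ × ℝ → ℝ} {U : Set (ℝ × ℝ)} {X : ℝ × ℝ → H1} {u : ℝ × ℝ}

theorem contDiffOn_contactY (h : StructureEqs c α U X) : ContDiffOn ℝ ∞ (contactY X) U := by
  have hy := contDiffOn_dY h.isOpen h.smooth
  exact (hy.snd.snd.add (h.smooth.fst.mul hy.snd.fst)).sub (h.smooth.snd.fst.mul hy.fst)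

theorem contDiffOn_shiftY (h : StructureEqs c α U X) : ContDiffOn ℝ ∞ (shiftY X) U := by
  have hx := contDiffOn_dX h.isOpen h.smooth
  have hy := contDiffOn_dY h.isOpen h.smooth
  exact ((hx.fst.mul hy.fst).add (hx.snd.fst.mul hy.snd.fst)).neg

theorem contDiffOn_normalY (h : StructureEqs c α U X) : ContDiffOn ℝ ∞ (normalY X) U := by
  have hx := contDiffOn_dX h.isOpen h.smooth
  have hy := contDiffOn_dY h.isOpen h.smooth
  exact (hx.fst.mul hy.snd.fst).sub (hx.snd.fst.mul hy.fst)

theorem normalY_eq (h : StructureEqs c α U X) (hu : u ∈ U) : normalY X u = α u * contactY X u :=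
  (h.alpha u hu).symm

theorem contactY_ne_zero (h : StructureEqs c α U X) (hu : u ∈ U) : contactY X u ≠ 0 :=
  h.transverse u hu

theorem alpha_eq (h : StructureEqs c α U X) (hu : u ∈ U) : α u = normalY X u / contactY X u := by
  rw [h.normalY_eq hu, mul_div_cancel_right₀ _ (h.contactY_ne_zero hu)]

theorem contDiffOn_alpha (h : StructureEqs c α U X) : ContDiffOn ℝ ∞ α U :=
  (h.contDiffOn_normalY.div h.contDiffOn_contactY fun _ hu => h.contactY_ne_zero hu).congr
    fun _ hu => h.alpha_eq hu

theorem hasDy_dX_fst (h : StructureEqs c α U X) (hu : u ∈ U) :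
    HasDy (fun v => (dX X v).1) (Dy (fun v => (dX X v).1) u) u :=
  hasDy h.isOpen (contDiffOn_dX h.isOpen h.smooth).fst hu

theorem hasDy_dX_snd (h : StructureEqs c α U X) (hu : u ∈ U) :
    HasDy (fun v => (dX X v).2.1) (Dy (fun v => (dX X v).2.1) u) u :=
  hasDy h.isOpen (contDiffOn_dX h.isOpen h.smooth).snd.fst hu

/-- The unit vector `∂/∂x` is orthogonal to its derivative. -/
theorem dX_mul_Dy (h : StructureEqs c α U X) (hu : u ∈ U) :
    (dX X u).1 * Dy (fun v => (dX X v).1) u +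
    (dX X u).2.1 * Dy (fun v => (dX X v).2.1) u = 0 := by
  have h1 : HasDy (fun v => (dX X v).1 ^ 2 + (dX X v).2.1 ^ 2) _ u :=
    ((h.hasDy_dX_fst hu).pow 2).add ((h.hasDy_dX_snd hu).pow 2)
  have h2 : HasDy (fun v => (dX X v).1 ^ 2 + (dX X v).2.1 ^ 2) 0 u :=
    HasDy.congr (hasDerivAt_const _ (1 : ℝ)) h.isOpen hu fun v hv => h.unit v hv
  have := h1.unique h2
  norm_num at this
  linarith

/-- The derivative of a plane unit vector is its angular speed times the vector turned by a right
angle. The speed is defined without an angle function, so this is valid on any domain. -/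
theorem Dy_dX_fst (h : StructureEqs c α U X) (hu : u ∈ U) :
    Dy (fun v => (dX X v).1) u = -(angleY X u * (dX X u).2.1) := by
  rw [angleY]
  linear_combination (dX X u).1 * h.dX_mul_Dy hu - Dy (fun v => (dX X v).1) u * h.unit u hu

theorem Dy_dX_snd (h : StructureEqs c α U X) (hu : u ∈ U) :
    Dy (fun v => (dX X v).2.1) u = angleY X u * (dX X u).1 := by
  rw [angleY]
  linear_combination (dX X u).2.1 * h.dX_mul_Dy hu - Dy (fun v => (dX X v).2.1) u * h.unit u hu

theorem hasDx_dY_fst (h : StructureEqs c α U X) (hu : u ∈ U) :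
    HasDx (fun v => (dY X v).1) (Dy (fun v => (dX X v).1) u) u :=
  hasDx_dY_component h.isOpen h.smooth hu coordX

theorem hasDx_dY_snd (h : StructureEqs c α U X) (hu : u ∈ U) :
    HasDx (fun v => (dY X v).2.1) (Dy (fun v => (dX X v).2.1) u) u :=
  hasDx_dY_component h.isOpen h.smooth hu coordY

/-- Horizontally X_xx = c J X_x, and X_xy is orthogonal to X_x because X_x has unit length. Only
-c⟨J X_x, X_y⟩ survives. -/
theorem hasDx_shiftY (h : StructureEqs c α U X) (hu : u ∈ U) :
    HasDx (shiftY X) (-(c * (α u * contactY X u))) u := by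
  have h1 : HasDx (shiftY X) _ u := (((h.curvature_fst u hu).mul (h.hasDx_dY_fst hu)).add
    ((h.curvature_snd u hu).mul (h.hasDx_dY_snd hu))).neg
  refine h1.congr_deriv ?_
  rw [← h.normalY_eq hu, normalY]
  linear_combination -h.dX_mul_Dy hu

/-- The term ⟨J X_xx, X_y⟩ contributes cn, since J² = -1 on ξ, and ⟨J X_x, X_xy⟩ is the angular
speed. -/
theorem hasDx_normalY (h : StructureEqs c α U X) (hu : u ∈ U) :
    HasDx (normalY X) (angleY X u + c * shiftY X u) u := by
  have h1 : HasDx (normalY X) _ u := ((h.curvature_fst u hu).mul (h.hasDx_dY_snd hu)).sub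
    ((h.curvature_snd u hu).mul (h.hasDx_dY_fst hu))
  refine h1.congr_deriv ?_
  rw [shiftY, angleY]
  ring

/-- The third component of `∂/∂x`. -/
theorem dX_third (h : StructureEqs c α U X) (hu : u ∈ U) :
    (dX X u).2.2 = (X u).2.1 * (dX X u).1 - (X u).1 * (dX X u).2.1 := by
  have := h.horizontal u hu
  rw [contactForm_apply] at this
  linarith

/-- This is dΘ = 2 dx ∧ dy evaluated on X_x, X_y: since Θ(X_x) = 0, it gives m_x = 2w. -/
theorem hasDx_contactY (h : StructureEqs c α U X) (hu : u ∈ U) :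
    HasDx (contactY X) (2 * (α u * contactY X u)) u := by
  have hz := hasDx_dY_component h.isOpen h.smooth hu coordZ
  have hf := hasDx_component h.isOpen h.smooth hu coordX
  have hg := hasDx_component h.isOpen h.smooth hu coordY
  have hfy := hasDy_component h.isOpen h.smooth hu coordX
  have hgy := hasDy_component h.isOpen h.smooth hu coordY
  -- Horizontality expresses the third component of X_x through the others; differentiating it in y
  -- gives the mixed derivative needed below.
  have hzy : HasDy (fun v => (dX X v).2.2) _ u := HasDy.congr
    ((hgy.mul (h.hasDy_dX_fst hu)).sub (hfy.mul (h.hasDy_dX_snd hu))) h.isOpen hu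
    fun v hv => h.dX_third hv
  have hzy' := hasDy h.isOpen (contDiffOn_dX h.isOpen h.smooth).snd.snd hu
  have e := hzy'.unique hzy
  have h1 : HasDx (contactY X) _ u :=
    (hz.add (hf.mul (h.hasDx_dY_snd hu))).sub (hg.mul (h.hasDx_dY_fst hu))
  refine h1.congr_deriv ?_
  rw [← h.normalY_eq hu, normalY]
  simp only [coordX, coordY, coordZ, ContinuousLinearMap.coe_comp, Function.comp_apply,
    ContinuousLinearMap.coe_fst', ContinuousLinearMap.coe_snd'] at e ⊢
  rw [e]
  ring

/-- Since θ_x = c is constant, θ_yx = θ_xy = 0. -/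
theorem hasDx_angleY (h : StructureEqs c α U X) (hu : u ∈ U) : HasDx (angleY X) 0 u := by
  have hd := contDiffOn_dX h.isOpen h.smooth
  have ex (v : ℝ × ℝ) (hv : v ∈ U) : Dx (fun v => (dX X v).1) v = -(c * (dX X v).2.1) :=
    (hasDx h.isOpen hd.fst hv).unique (h.curvature_fst v hv)
  have ey (v : ℝ × ℝ) (hv : v ∈ U) : Dx (fun v => (dX X v).2.1) v = c * (dX X v).1 :=
    (hasDx h.isOpen hd.snd.fst hv).unique (h.curvature_snd v hv)
  have h1 := hasDx h.isOpen (contDiffOn_Dy h.isOpen hd.fst) hu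
  have h2 := hasDx h.isOpen (contDiffOn_Dy h.isOpen hd.snd.fst) hu
  have e1 : Dx (Dy fun v => (dX X v).1) u = -(c * Dy (fun v => (dX X v).2.1) u) := by
    rw [← Dx_Dy_comm h.isOpen hd.fst hu]
    exact (hasDy h.isOpen (contDiffOn_Dx h.isOpen hd.fst) hu).unique
      (HasDy.congr (((h.hasDy_dX_snd hu).const_mul c).neg) h.isOpen hu ex)
  have e2 : Dx (Dy fun v => (dX X v).2.1) u = c * Dy (fun v => (dX X v).1) u := by
    rw [← Dx_Dy_comm h.isOpen hd.snd.fst hu]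
    exact (hasDy h.isOpen (contDiffOn_Dx h.isOpen hd.snd.fst) hu).unique
      (HasDy.congr ((h.hasDy_dX_fst hu).const_mul c) h.isOpen hu ey)
  have h3 : HasDx (angleY X) _ u :=
    ((h.curvature_fst u hu).mul h2).sub ((h.curvature_snd u hu).mul h1)
  refine h3.congr_deriv ?_
  rw [e1, e2]
  ring

/-- The α-function solves the equation of Liénard type. -/
theorem isLienardSolution (h : StructureEqs c α U X) : IsLienardSolution c U α := by
  refine ⟨h.contDiffOn_alpha, fun u hu => ?_⟩
  have hα := h.contDiffOn_alpha
  have hαx (v : ℝ × ℝ) (hv : v ∈ U) : HasDx α (Dx α v) v := hasDx h.isOpen hα hv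
  have hpx (v : ℝ × ℝ) (hv : v ∈ U) : partialX α v = Dx α v := (hαx v hv).deriv
  have hxx := hasDx h.isOpen (contDiffOn_Dx h.isOpen hα) hu
  have hpxx : partialX (partialX α) u = Dx (Dx α) u := (HasDx.congr hxx h.isOpen hu hpx).deriv
  -- Two expressions for w_x, one from w = αm and one from the structure equations; the next
  -- derivative in x removes the angular speed.
  have first (v : ℝ × ℝ) (hv : v ∈ U) :
      contactY X v * Dx α v = angleY X v + c * shiftY X v - 2 * (α v ^ 2 * contactY X v) := by
    have h1 : HasDx (normalY X) _ v := HasDx.congr ((hαx v hv).mul (h.hasDx_contactY hv))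
      h.isOpen hv fun w hw => h.normalY_eq hw
    linear_combination h1.unique (h.hasDx_normalY hv)
  have h2 : HasDx (fun v => contactY X v * Dx α v) _ u := (h.hasDx_contactY hu).mul hxx
  have h3 : HasDx (fun v => contactY X v * Dx α v) _ u := HasDx.congr
    (((h.hasDx_angleY hu).add ((h.hasDx_shiftY hu).const_mul c)).sub
      ((((hαx u hu).pow 2).mul (h.hasDx_contactY hu)).const_mul 2)) h.isOpen hu first
  have e := h2.unique h3
  have hne := h.contactY_ne_zero hu
  rw [hpxx, hpx u hu]
  refine mul_left_cancel₀ hne ?_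
  norm_num at e
  linear_combination e

end StructureEqs

/-! ### Characteristic curves and compatible coordinates -/

/-- A smooth function on the line has a smooth antiderivative vanishing at `0`. -/
theorem exists_smooth_antideriv {g : ℝ → ℝ} (hg : ContDiff ℝ ∞ g) :
    ∃ F : ℝ → ℝ, F 0 = 0 ∧ ContDiff ℝ ∞ F ∧ ∀ t, HasDerivAt F (g t) t := by
  have hd (t : ℝ) : HasDerivAt (fun t => ∫ s in (0 : ℝ)..t, g s) (g t) t :=
    intervalIntegral.integral_hasDerivAt_right (hg.continuous.intervalIntegrable _ _)
      (hg.continuous.stronglyMeasurableAtFilter _ _) hg.continuous.continuousAt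
  refine ⟨fun t => ∫ s in (0 : ℝ)..t, g s, by simp, ?_, hd⟩
  rw [contDiff_infty_iff_deriv]
  exact ⟨fun t => (hd t).differentiableAt, by rwa [funext fun t => (hd t).deriv]⟩

/-- Two real functions on an interval around `0` with equal derivatives and equal value at `0`
agree. -/
theorem eq_on_of_hasDerivAt {F G D : ℝ → ℝ} {ε : ℝ}
    (hF : ∀ t ∈ Ioo (-ε) ε, HasDerivAt F (D t) t) (hG : ∀ t ∈ Ioo (-ε) ε, HasDerivAt G (D t) t)
    (h0 : F 0 = G 0) : ∀ t ∈ Ioo (-ε) ε, F t = G t := by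
  intro t ht
  have hε : 0 < ε := by linarith [ht.1, ht.2]
  have hd (s : ℝ) (hs : s ∈ Ioo (-ε) ε) : HasDerivAt (fun s => F s - G s) 0 s :=
    ((hF s hs).sub (hG s hs)).congr_deriv (sub_self _)
  have := isOpen_Ioo.is_const_of_deriv_eq_zero isPreconnected_Ioo
    (fun s hs => (hd s hs).differentiableAt.differentiableWithinAt)
    (fun s hs => (hd s hs).deriv) ht (show (0 : ℝ) ∈ Ioo (-ε) ε by simp [hε])
  simp only [h0, sub_self] at this
  linarith

/-- The horizontal curves of constant curvature `c` depend smoothly on their initial data: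
`Ψ P v t` is the curve with initial position `P` and initial velocity with horizontal
components `v`. -/
theorem exists_helix (c : ℝ) : ∃ Ψ : H1 × (ℝ × ℝ) × ℝ → H1, ContDiff ℝ ∞ Ψ ∧
    (∀ P v, Ψ (P, v, 0) = P) ∧
    ∀ (ε : ℝ) (γ : ℝ → H1) (p q : ℝ → ℝ),
      (∀ t ∈ Ioo (-ε) ε, HasDerivAt (fun s => (γ s).1) (p t) t) →
      (∀ t ∈ Ioo (-ε) ε, HasDerivAt (fun s => (γ s).2.1) (q t) t) →
      (∀ t ∈ Ioo (-ε) ε,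
        HasDerivAt (fun s => (γ s).2.2) ((γ t).2.1 * p t - (γ t).1 * q t) t) →
      (∀ t ∈ Ioo (-ε) ε, HasDerivAt p (-(c * q t)) t) →
      (∀ t ∈ Ioo (-ε) ε, HasDerivAt q (c * p t) t) →
      ∀ t ∈ Ioo (-ε) ε, γ t = Ψ (γ 0, (p 0, q 0), t) := by
  have hcos : ContDiff ℝ ∞ (fun t : ℝ => Real.cos (c * t)) := by fun_prop
  have hsin : ContDiff ℝ ∞ (fun t : ℝ => Real.sin (c * t)) := by fun_prop
  obtain ⟨S, hS0, hS, hS'⟩ := exists_smooth_antideriv hcos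
  obtain ⟨C, hC0, hC, hC'⟩ := exists_smooth_antideriv hsin
  -- Working with antiderivatives instead of sin(ct)/c and the like covers c = 0 as well. `D` gives
  -- the vertical displacement of the curve starting at the origin with unit speed; for a general
  -- initial velocity it scales with the squared speed, and the initial position adds a left
  -- translation.
  obtain ⟨D, hD0, hD, hD'⟩ := exists_smooth_antideriv
    (((hC.mul hcos).sub (hS.mul hsin)) :
      ContDiff ℝ ∞ (fun t => C t * Real.cos (c * t) - S t * Real.sin (c * t)))
  refine ⟨fun w => (w.1.1 + (w.2.1.1 * S w.2.2 - w.2.1.2 * C w.2.2),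
    w.1.2.1 + (w.2.1.2 * S w.2.2 + w.2.1.1 * C w.2.2),
    w.1.2.2 + w.1.2.1 * (w.2.1.1 * S w.2.2 - w.2.1.2 * C w.2.2)
      - w.1.1 * (w.2.1.2 * S w.2.2 + w.2.1.1 * C w.2.2)
      + (w.2.1.1 ^ 2 + w.2.1.2 ^ 2) * D w.2.2), ?_, ?_, ?_⟩
  · fun_prop
  · intro P v
    simp [hS0, hC0, hD0]
  · intro ε γ p q hf hg hz hp hq
    have dcos (t : ℝ) : HasDerivAt (fun t => Real.cos (c * t)) (-(c * Real.sin (c * t))) t :=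
      (((hasDerivAt_id t).const_mul c).cos).congr_deriv (by simp; ring)
    have dsin (t : ℝ) : HasDerivAt (fun t => Real.sin (c * t)) (c * Real.cos (c * t)) t :=
      (((hasDerivAt_id t).const_mul c).sin).congr_deriv (by simp; ring)
    -- The velocity turned back by the angle ct is constant, which replaces an appeal to uniqueness
    -- for differential equations.
    have r1 : ∀ t ∈ Ioo (-ε) ε, p t * Real.cos (c * t) + q t * Real.sin (c * t) = p 0 :=
      eq_on_of_hasDerivAt (D := fun _ => 0)
        (fun t ht => (((hp t ht).mul (dcos t)).add ((hq t ht).mul (dsin t))).congr_deriv (by ring))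
        (fun t _ => hasDerivAt_const t _) (by simp)
    have r2 : ∀ t ∈ Ioo (-ε) ε, q t * Real.cos (c * t) - p t * Real.sin (c * t) = q 0 :=
      eq_on_of_hasDerivAt (D := fun _ => 0)
        (fun t ht => (((hq t ht).mul (dcos t)).sub ((hp t ht).mul (dsin t))).congr_deriv (by ring))
        (fun t _ => hasDerivAt_const t _) (by simp)
    have ep (t : ℝ) (ht : t ∈ Ioo (-ε) ε) :
        p t = p 0 * Real.cos (c * t) - q 0 * Real.sin (c * t) := by
      rw [← r1 t ht, ← r2 t ht]
      linear_combination (-(p t)) * Real.sin_sq_add_cos_sq (c * t)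
    have eq (t : ℝ) (ht : t ∈ Ioo (-ε) ε) :
        q t = q 0 * Real.cos (c * t) + p 0 * Real.sin (c * t) := by
      rw [← r1 t ht, ← r2 t ht]
      linear_combination (-(q t)) * Real.sin_sq_add_cos_sq (c * t)
    have ef : ∀ t ∈ Ioo (-ε) ε, (γ t).1 = (γ 0).1 + (p 0 * S t - q 0 * C t) :=
      eq_on_of_hasDerivAt hf
        (fun t ht => ((((hS' t).const_mul (p 0)).sub ((hC' t).const_mul (q 0))).const_add
          _).congr_deriv (ep t ht).symm) (by simp [hS0, hC0])
    have eg : ∀ t ∈ Ioo (-ε) ε, (γ t).2.1 = (γ 0).2.1 + (q 0 * S t + p 0 * C t) :=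
      eq_on_of_hasDerivAt hg
        (fun t ht => ((((hS' t).const_mul (q 0)).add ((hC' t).const_mul (p 0))).const_add
          _).congr_deriv (eq t ht).symm) (by simp [hS0, hC0])
    have ez : ∀ t ∈ Ioo (-ε) ε, (γ t).2.2 = (γ 0).2.2 + (γ 0).2.1 * (p 0 * S t - q 0 * C t)
        - (γ 0).1 * (q 0 * S t + p 0 * C t) + (p 0 ^ 2 + q 0 ^ 2) * D t :=
      eq_on_of_hasDerivAt hz
        (fun t ht => ((((((hS' t).const_mul (p 0)).sub ((hC' t).const_mul (q 0))).const_mul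
          (γ 0).2.1).const_add (γ 0).2.2).sub ((((hS' t).const_mul (q 0)).add
          ((hC' t).const_mul (p 0))).const_mul (γ 0).1)).add
          ((hD' t).const_mul (p 0 ^ 2 + q 0 ^ 2)) |>.congr_deriv (by
            rw [ef t ht, eg t ht, ep t ht, eq t ht]; ring)) (by simp [hS0, hC0, hD0])
    intro t ht
    exact Prod.ext (ef t ht) (Prod.ext (eg t ht) (ez t ht))

section FlowBox

variable {c : ℝ} {S : Set H1} {e : H1 → H1} {U : Set (ℝ × ℝ)} {Y : ℝ × ℝ → H1} {u₀ : ℝ × ℝ}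

/-- The characteristic direction in the coordinates of a chart. -/
theorem IsChart.exists_vectorField (hS : IsCMCSurface c S e) (hY : IsChart S U Y) :
    ∃ v : ℝ × ℝ → ℝ × ℝ, ∀ u ∈ U, fderiv ℝ Y u (v u) = e (Y u) ∧ ContDiffAt ℝ ∞ v u := by
  have hE := hY.isSmoothEmbedding
  have hex (u : ℝ × ℝ) : ∃ w, u ∈ U → fderiv ℝ Y u w = e (Y u) := by
    by_cases hu : u ∈ U
    · have := hS.characteristic.tangent _ (hY.mem hu)
      rw [hY.tangentPlane_eq hu] at this
      obtain ⟨w, hw⟩ := this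
      exact ⟨w, fun _ => hw⟩
    · exact ⟨0, fun h => absurd h hu⟩
  choose v hv using hex
  refine ⟨v, fun u hu => ⟨hv u hu, ?_⟩⟩
  obtain ⟨L, hL, -, hLY, -⟩ := hY.exists_coordinates hu
  have he := (hS.characteristic.smooth U Y hY).contDiffAt (hE.isOpen.mem_nhds hu)
  -- The chosen vectors are the images of `e` under the differential of a smooth left inverse of the
  -- chart, hence smooth.
  have hs : ContDiffAt ℝ ∞ (fun w => fderiv ℝ L (Y w) (e (Y w))) u :=
    ((hL.fderiv_right (m := ∞) (by simp)).comp u (hE.contDiffAt hu)).clm_apply he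
  refine hs.congr_of_eventuallyEq ?_
  have hLd : ∀ᶠ P in 𝓝 (Y u), DifferentiableAt ℝ L P :=
    ((hL.of_le (m := 1) (by simp)).eventually (by simp)).mono
      fun P hP => hP.differentiableAt (by simp)
  filter_upwards [hLY.eventually_nhds, (hE.contDiffAt hu).continuousAt.eventually hLd,
    hE.isOpen.mem_nhds hu] with w hw hLw hwU
  have h1 := hLw.hasFDerivAt.comp w (hE.hasFDerivAt hwU)
  have h2 : HasFDerivAt (L ∘ Y) (ContinuousLinearMap.id ℝ (ℝ × ℝ)) w :=
    (hasFDerivAt_id w).congr_of_eventuallyEq hw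
  rw [← hv w hwU]
  exact (DFunLike.congr_fun (h1.unique h2) (v w)).symm

/-- A local flow of a `C¹` vector field near a point of an open set, staying in that set. -/
theorem exists_local_flow {v : ℝ × ℝ → ℝ × ℝ} (hU : IsOpen U) (hu : u₀ ∈ U)
    (hv : ContDiffAt ℝ 1 v u₀) :
    ∃ δ > 0, ∃ Φ : (ℝ × ℝ) × ℝ → ℝ × ℝ,
      ContinuousOn Φ (Metric.ball u₀ δ ×ˢ Ioo (-δ) δ) ∧
      ∀ u ∈ Metric.ball u₀ δ, Φ (u, 0) = u ∧
        ∀ t ∈ Ioo (-δ) δ, Φ (u, t) ∈ U ∧ HasDerivAt (fun s => Φ (u, s)) (v (Φ (u, t))) t := by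
  obtain ⟨ε, hε, a, r, L, K, hr, hpl⟩ := IsPicardLindelof.of_contDiffAt_one hv
  obtain ⟨Φ, hΦ, hc⟩ :=
    (hpl 0).exists_forall_mem_closedBall_eq_hasDerivWithinAt_continuousOn
  have hr' : (0 : ℝ) < r := hr
  have hmem : (Metric.closedBall u₀ (r : ℝ)) ×ˢ Icc (0 - ε) (0 + ε) ∈ 𝓝 (u₀, (0 : ℝ)) :=
    prod_mem_nhds (Metric.closedBall_mem_nhds _ hr') (Icc_mem_nhds (by linarith) (by linarith))
  have h0 : Φ (u₀, 0) = u₀ := (hΦ u₀ (Metric.mem_closedBall_self hr'.le)).1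
  have hev : ∀ᶠ w in 𝓝 (u₀, (0 : ℝ)), Φ w ∈ U :=
    (hc.continuousAt hmem).eventually (hU.mem_nhds (by rwa [h0]))
  obtain ⟨η, hη, hball⟩ := Metric.eventually_nhds_iff_ball.1 hev
  let δ := min η (min r ε)
  have hδ : 0 < δ := by positivity
  have hδη : δ ≤ η := min_le_left _ _
  have hδr : δ ≤ r := (min_le_right _ _).trans (min_le_left _ _)
  have hδε : δ ≤ ε := (min_le_right _ _).trans (min_le_right _ _)
  have hb (u : ℝ × ℝ) (hu : u ∈ Metric.ball u₀ δ) : u ∈ Metric.closedBall u₀ (r : ℝ) :=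
    Metric.ball_subset_closedBall (Metric.ball_subset_ball hδr hu)
  have ht' (t : ℝ) (ht : t ∈ Ioo (-δ) δ) : t ∈ Ioo (0 - ε) (0 + ε) :=
    ⟨by linarith [ht.1], by linarith [ht.2]⟩
  refine ⟨δ, hδ, Φ, hc.mono (prod_mono hb fun t ht => Ioo_subset_Icc_self (ht' t ht)), ?_⟩
  intro u hu
  refine ⟨(hΦ u (hb u hu)).1, fun t ht => ⟨hball _ ?_, ?_⟩⟩
  · rw [← ball_prod_same]
    refine ⟨Metric.ball_subset_ball hδη hu, Metric.ball_subset_ball hδη ?_⟩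
    rw [Real.ball_eq_Ioo]
    simpa using ht
  · exact ((hΦ u (hb u hu)).2 t (Ioo_subset_Icc_self (ht' t ht))).hasDerivAt
      (Icc_mem_nhds (ht' t ht).1 (ht' t ht).2)

/-- The position and velocity of a curve in `S` with velocity `e` satisfy the equations of a
horizontal curve of constant curvature. -/
theorem IsChart.helix_equations (hS : IsCMCSurface c S e) (hY : IsChart S U Y)
    {β : ℝ → ℝ × ℝ} {w : ℝ × ℝ} {t : ℝ} (hβ : HasDerivAt β w t) (hU : β t ∈ U)
    (hw : fderiv ℝ Y (β t) w = e (Y (β t))) :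
    HasDerivAt (fun s => Y (β s)) (e (Y (β t))) t ∧
    HasDerivAt (fun s => (Y (β s)).1) (e (Y (β t))).1 t ∧
    HasDerivAt (fun s => (Y (β s)).2.1) (e (Y (β t))).2.1 t ∧
    HasDerivAt (fun s => (Y (β s)).2.2)
      ((Y (β t)).2.1 * (e (Y (β t))).1 - (Y (β t)).1 * (e (Y (β t))).2.1) t ∧
    HasDerivAt (fun s => (e (Y (β s))).1) (-(c * (e (Y (β t))).2.1)) t ∧
    HasDerivAt (fun s => (e (Y (β s))).2.1) (c * (e (Y (β t))).1) t := by
  have hE := hY.isSmoothEmbedding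
  have hγ : HasDerivAt (fun s => Y (β s)) (e (Y (β t))) t :=
    ((hE.hasFDerivAt hU).comp_hasDerivAt t hβ).congr_deriv hw
  have he := hS.characteristic.smooth U Y hY
  have hf := hY.fderiv_field hS hU hw
  have hh : contactForm _ _ = 0 := hS.characteristic.horizontal _ (hY.mem hU)
  rw [contactForm_apply] at hh
  refine ⟨hγ, coordX.hasFDerivAt.comp_hasDerivAt t hγ, coordY.hasFDerivAt.comp_hasDerivAt t hγ,
    (coordZ.hasFDerivAt.comp_hasDerivAt t hγ).congr_deriv ?_, ?_, ?_⟩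
  · change (e (Y (β t))).2.2 = _
    linarith
  · exact ((hasFDerivAt_of_contDiffOn hE.isOpen he.fst hU).comp_hasDerivAt t hβ).congr_deriv hf.1
  · exact ((hasFDerivAt_of_contDiffOn hE.isOpen he.snd.fst hU).comp_hasDerivAt t
      hβ).congr_deriv hf.2

/-- If `X = Y ∘ φ` with `Y` a chart, `φ` continuous and `X` smooth, then `φ` is smooth. -/
theorem IsChart.contDiffAt_of_comp (hY : IsChart S U Y) {X : ℝ × ℝ → H1} {φ : ℝ × ℝ → ℝ × ℝ}
    {q : ℝ × ℝ} (hX : ContDiffAt ℝ ∞ X q) (hφ : ContinuousAt φ q) (hq : φ q ∈ U)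
    (h : ∀ᶠ r in 𝓝 q, Y (φ r) = X r) : ContDiffAt ℝ ∞ φ q := by
  obtain ⟨L, hL, -, hLY, -⟩ := hY.exists_coordinates hq
  rw [h.self_of_nhds] at hL
  refine (hL.comp q hX).congr_of_eventuallyEq ?_
  filter_upwards [h, hφ.eventually hLY] with r hr hLr
  rw [Function.comp_apply, ← hr, hLr]

/-- If the embedding `X` factors through a chart, it is a chart. -/
theorem IsChart.of_comp (hY : IsChart S U Y) {X : ℝ × ℝ → H1} {W : Set (ℝ × ℝ)}
    {φ : ℝ × ℝ → ℝ × ℝ} (hX : IsSmoothEmbedding W X) (hφ : ContinuousOn φ W)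
    (hU : ∀ q ∈ W, φ q ∈ U) (h : ∀ q ∈ W, Y (φ q) = X q) : IsChart S W X := by
  have hE := hY.isSmoothEmbedding
  -- Since `Y ∘ φ` is an immersion, the differential of `φ` is injective between planes, hence onto,
  -- so `φ` is an open map; relative openness of `X '' W` then follows from the chart `Y`.
  have hopen : IsOpen (φ '' W) := by
    rw [isOpen_iff_mem_nhds]
    rintro _ ⟨q, hq, rfl⟩
    have hev : ∀ᶠ r in 𝓝 q, Y (φ r) = X r := (hX.isOpen.eventually_mem hq).mono h
    have hs := hY.contDiffAt_of_comp (hX.contDiffAt hq)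
      (hφ.continuousAt (hX.isOpen.mem_nhds hq)) (hU q hq) hev
    have hcomp := (hE.hasFDerivAt (hU q hq)).comp q (hs.differentiableAt (by simp)).hasFDerivAt
    have heq := (hcomp.congr_of_eventuallyEq (hev.mono fun r hr => hr.symm)).unique
      (hX.hasFDerivAt hq)
    have hinj : Function.Injective (fderiv ℝ φ q) := by
      have := hX.immersion q hq
      rw [← heq, ContinuousLinearMap.coe_comp] at this
      exact this.of_comp
    have hsurj := (LinearMap.injective_iff_surjective
      (f := (fderiv ℝ φ q : ℝ × ℝ →ₗ[ℝ] ℝ × ℝ))).1 hinj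
    rw [← (hs.hasStrictFDerivAt (by simp)).map_nhds_eq_of_surj (LinearMap.range_eq_top.2 hsurj)]
    exact image_mem_map (hX.isOpen.mem_nhds hq)
  obtain ⟨O, hO, hOe⟩ := hY.exists_open_image hopen (by rintro _ ⟨q, hq, rfl⟩; exact hU q hq)
  refine ⟨hX, O, hO, ?_⟩
  rw [← hOe, image_image]
  exact image_congr fun q hq => (h q hq).symm

/-- Every point has a compatible coordinate system around it. -/
theorem IsCMCSurface.exists_compatibleChart (hS : IsCMCSurface c S e) {p : H1} (hp : p ∈ S) :
    ∃ W X, IsCompatibleChart S e W X ∧ p ∈ X '' W := by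
  obtain ⟨U, Y, hY, u₀, hu₀, rfl⟩ := hS.isSurface p hp
  have hE := hY.isSmoothEmbedding
  have he := hS.characteristic.smooth U Y hY
  obtain ⟨v, hv⟩ := hY.exists_vectorField hS
  obtain ⟨δ, hδ, Φ, hΦc, hΦ⟩ :=
    exists_local_flow hE.isOpen hu₀ ((hv u₀ hu₀).2.of_le (m := 1) (by simp))
  obtain ⟨Ψ, hΨ, hΨ0, hΨu⟩ := exists_helix c
  -- The characteristic direction at `u₀` turned by a right angle, so that the line `σ` is
  -- transverse to the flow.
  let w : ℝ × ℝ := (-(v u₀).2, (v u₀).1)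
  let σ : ℝ → ℝ × ℝ := fun y => u₀ + y • w
  have hσ : ContDiff ℝ ∞ σ := contDiff_const.add (contDiff_id.smul contDiff_const)
  have hσ0 : σ 0 = u₀ := by simp [σ]
  -- Defined by the explicit curves, so smoothness is immediate; the flow `φ` below is used to see
  -- that `X` takes its values in the surface.
  let X : ℝ × ℝ → H1 := fun q =>
    Ψ (Y (σ q.2), ((e (Y (σ q.2))).1, (e (Y (σ q.2))).2.1), q.1)
  let N : Set (ℝ × ℝ) := {q | q.1 ∈ Ioo (-δ) δ ∧ σ q.2 ∈ Metric.ball u₀ δ}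
  have hNo : IsOpen N := (isOpen_Ioo.preimage continuous_fst).inter
    (Metric.isOpen_ball.preimage (hσ.continuous.comp continuous_snd))
  have h0N : ((0 : ℝ), (0 : ℝ)) ∈ N :=
    ⟨by simpa using hδ, by simpa [hσ0] using hδ⟩
  have hσU (q : ℝ × ℝ) (hq : q ∈ N) : σ q.2 ∈ U := by
    have h := hΦ _ hq.2
    rw [← h.1]
    exact (h.2 0 (by simpa using hδ)).1
  let φ : ℝ × ℝ → ℝ × ℝ := fun q => Φ (σ q.2, q.1)
  have hφU (q : ℝ × ℝ) (hq : q ∈ N) : φ q ∈ U := ((hΦ _ hq.2).2 _ hq.1).1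
  have hφc : ContinuousOn φ N :=
    hΦc.comp (((hσ.continuous.comp continuous_snd).prodMk continuous_fst).continuousOn)
      fun q hq => ⟨hq.2, hq.1⟩
  have hcurve (q : ℝ × ℝ) (hq : q ∈ N) (t : ℝ) (ht : t ∈ Ioo (-δ) δ) :=
    hY.helix_equations hS ((hΦ _ hq.2).2 t ht).2 ((hΦ _ hq.2).2 t ht).1
      (hv _ ((hΦ _ hq.2).2 t ht).1).1
  have hYφ (q : ℝ × ℝ) (hq : q ∈ N) : Y (φ q) = X q := by
    have := hΨu δ (fun t => Y (Φ (σ q.2, t))) (fun t => (e (Y (Φ (σ q.2, t)))).1)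
      (fun t => (e (Y (Φ (σ q.2, t)))).2.1)
      (fun t ht => (hcurve q hq t ht).2.1) (fun t ht => (hcurve q hq t ht).2.2.1)
      (fun t ht => (hcurve q hq t ht).2.2.2.1) (fun t ht => (hcurve q hq t ht).2.2.2.2.1)
      (fun t ht => (hcurve q hq t ht).2.2.2.2.2) q.1 hq.1
    simp only [(hΦ _ hq.2).1] at this
    exact this
  have hXs : ContDiffOn ℝ ∞ X N := by
    have hσ' : ContDiffOn ℝ ∞ (fun q : ℝ × ℝ => σ q.2) N := (hσ.comp contDiff_snd).contDiffOn
    have hYσ : ContDiffOn ℝ ∞ (fun q : ℝ × ℝ => Y (σ q.2)) N := hE.smooth.comp hσ' hσU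
    have heσ : ContDiffOn ℝ ∞ (fun q : ℝ × ℝ => e (Y (σ q.2))) N := he.comp hσ' hσU
    exact hΨ.comp_contDiffOn (hYσ.prodMk ((heσ.fst.prodMk heσ.snd.fst).prodMk contDiffOn_fst))
  have hdX (q : ℝ × ℝ) (hq : q ∈ N) : dX X q = e (X q) := by
    have h1 := hasDerivAt_slice_fst (hasFDerivAt_of_contDiffOn hNo hXs hq)
    have h2 := (hcurve q hq q.1 hq.1).1
    have h3 := h2.congr_of_eventuallyEq (f₁ := fun t => X (t, q.2))
      ((slice_fst_mem hNo hq).mono fun t ht => (hYφ _ ht).symm)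
    have h4 : e (Y (φ q)) = e (X q) := by rw [hYφ q hq]
    exact (h1.unique h3).trans h4
  have hX0 (y : ℝ) : X (0, y) = Y (σ y) := hΨ0 _ _
  have hdY0 : dY X (0, 0) = fderiv ℝ Y u₀ w := by
    have h1 := hasDerivAt_slice_snd (hasFDerivAt_of_contDiffOn hNo hXs h0N)
    have h2 : HasDerivAt σ w 0 :=
      (((hasDerivAt_id (0 : ℝ)).smul_const w).const_add u₀).congr_deriv (one_smul _ _)
    have h3 : HasFDerivAt Y (fderiv ℝ Y u₀) (σ 0) := by rw [hσ0]; exact hE.hasFDerivAt hu₀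
    have h4 := h3.comp_hasDerivAt (0 : ℝ) h2
    have h5 : (fun t => X (0, t)) = Y ∘ σ := funext hX0
    exact h1.unique (by rw [h5]; exact h4)
  have hinj : Function.Injective (fderiv ℝ X (0, 0)) := by
    rw [injective_iff_map_eq_zero]
    intro z hz
    have hX00 : X (0, 0) = Y u₀ := by rw [hX0, hσ0]
    rw [fderiv_eq_combination, hdX _ h0N, hdY0, hX00, ← (hv u₀ hu₀).1, ← map_smul, ← map_smul,
      ← map_add] at hz
    have hz' := (injective_iff_map_eq_zero _).1 (hE.immersion u₀ hu₀) _ hz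
    have hz1 := congrArg Prod.fst hz'
    have hz2 := congrArg Prod.snd hz'
    simp only [Prod.fst_add, Prod.snd_add, Prod.smul_fst, Prod.smul_snd, smul_eq_mul, w,
      Prod.fst_zero, Prod.snd_zero] at hz1 hz2
    -- This is the determinant of the pair `v u₀`, `w`; it is nonzero because `e` has unit length.
    have hv0 : (v u₀).1 ^ 2 + (v u₀).2 ^ 2 ≠ 0 := by
      intro h
      have e1 : (v u₀).1 = 0 := by nlinarith [sq_nonneg (v u₀).1, sq_nonneg (v u₀).2]
      have e2 : (v u₀).2 = 0 := by nlinarith [sq_nonneg (v u₀).1, sq_nonneg (v u₀).2]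
      have e3 : v u₀ = 0 := Prod.ext e1 e2
      have e4 := hS.characteristic.unit _ (hY.mem hu₀)
      rw [← (hv u₀ hu₀).1, e3, map_zero] at e4
      simp [adaptedMetric] at e4
    have z1 : z.1 = 0 := by
      refine (mul_eq_zero.1 ?_).resolve_right hv0
      linear_combination (v u₀).1 * hz1 + (v u₀).2 * hz2
    have z2 : z.2 = 0 := by
      refine (mul_eq_zero.1 ?_).resolve_right hv0
      linear_combination (v u₀).1 * hz2 - (v u₀).2 * hz1
    exact Prod.ext z1 z2
  obtain ⟨W, hWN, h0W, hW⟩ := exists_isSmoothEmbedding hNo hXs h0N hinj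
  refine ⟨W, X, ⟨hY.of_comp hW (hφc.mono hWN) (fun q hq => hφU q (hWN hq))
    fun q hq => hYφ q (hWN hq), fun q hq => hdX q (hWN hq)⟩, (0, 0), h0W, ?_⟩
  rw [hX0, hσ0]

end FlowBox

/-! ### Surfaces from the structure equations -/

section Realize

variable {c : ℝ} {α : ℝ × ℝ → ℝ} {W : Set (ℝ × ℝ)} {X : ℝ × ℝ → H1}

/-- The equation `∇_{e₁} e₂ = -c e₁` from its components. -/
theorem covDerivAlong_eq {γ V : ℝ → H1} {P w : H1} (hP : γ 0 = P) (hw : contactForm P w = 0)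
    (h1 : HasDerivAt (fun s => (V s).1) (-(c * w.2.1)) 0)
    (h2 : HasDerivAt (fun s => (V s).2.1) (c * w.1) 0) :
    covDerivAlong γ (fun t => cxJ (γ t) (V t)) 0 = -c • w := by
  simp only [covDerivAlong, cxJ_fst, cxJ_snd_fst, contactForm_cxJ, deriv_const, zero_smul,
    add_zero, deriv.fun_neg, h1.deriv, h2.deriv, hP]
  conv_rhs => rw [frame_expansion P w, hw]
  simp only [zero_smul, add_zero, smul_add, smul_smul, neg_mul]

/-- An embedding that satisfies the structure equations is a surface with p-mean curvature `c` and
α-function `α`. -/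
theorem StructureEqs.isRealization (h : StructureEqs c α W X) (hE : IsSmoothEmbedding W X) :
    IsRealization c α W X := by
  classical
  have hchart := hE.isChart_image
  -- The field and the α-function are transported to the image by this inverse; the values off `X ''
  -- W` are arbitrary and play no role.
  let inv : H1 → ℝ × ℝ := Function.invFunOn X W
  have hinv (u : ℝ × ℝ) (hu : u ∈ W) : inv (X u) = u := hE.injOn.leftInvOn_invFunOn hu
  have hd := contDiffOn_dX h.isOpen h.smooth
  refine ⟨hE, fun P => dX X (inv P), fun P => α (inv P), ⟨hE.isSurface_image, ?_, ⟨?_, ?_, ?_, ?_⟩,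
    ?_⟩, ⟨hchart, fun u hu => by rw [hinv u hu]⟩, ?_, fun u hu => congrArg α (hinv u hu)⟩
  · rintro _ ⟨u, hu, rfl⟩ hs
    rw [IsSingularPoint, hchart.tangentPlane_eq hu] at hs
    exact h.transverse u hu (hs.subset ⟨(0, 1), rfl⟩)
  · rintro _ ⟨u, hu, rfl⟩
    rw [hinv u hu, hchart.tangentPlane_eq hu]
    exact ⟨_, rfl⟩
  · rintro _ ⟨u, hu, rfl⟩
    rw [hinv u hu]
    exact h.horizontal u hu
  · rintro _ ⟨u, hu, rfl⟩
    rw [hinv u hu, adaptedMetric_self_of_horizontal (h.horizontal u hu)]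
    exact h.unit u hu
  · intro U Y hY w hw
    have hYs := hY.isSmoothEmbedding
    obtain ⟨u, hu, huw⟩ := hY.mem hw
    -- In a foreign chart `Y` the field is `dX X ∘ L ∘ Y` near `w`, with `L` a smooth ambient
    -- extension of the coordinates, since `inv` itself is defined by choice.
    obtain ⟨L, hL, hLu, -, hLS⟩ := hchart.exists_coordinates hu
    rw [huw] at hL hLS hLu
    have hs : ContDiffAt ℝ ∞ (fun w => dX X (L (Y w))) w := by
      refine ContDiffAt.comp w (g := dX X) ?_ (hL.comp w (hYs.contDiffAt hw))
      rw [hLu]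
      exact hd.contDiffAt (h.isOpen.mem_nhds hu)
    refine (hs.congr_of_eventuallyEq ?_).contDiffWithinAt
    have hlim : Tendsto Y (𝓝 w) (𝓝[X '' W] (Y w)) :=
      tendsto_nhdsWithin_iff.2 ⟨(hYs.contDiffAt hw).continuousAt,
        (hYs.isOpen.eventually_mem hw).mono fun w hw => hY.mem hw⟩
    filter_upwards [hlim.eventually hLS] with w' hw'
    have := hinv _ hw'.1
    rw [hw'.2] at this
    rw [this]
  · rintro _ ⟨u, hu, rfl⟩ γ hγ
    simp only [hinv u hu] at hγ ⊢
    obtain ⟨β, hβ, hβ0, hβγ, hβd⟩ := hchart.exists_curve hu hγ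
    -- Every curve with velocity `e` has coordinate velocity (1, 0), so only x-derivatives enter the
    -- curvature.
    have hβ1 : deriv β 0 = (1, 0) := hE.immersion u hu hβd
    have hβ' : HasDerivAt β (1, 0) 0 := hβ1 ▸ hβ.hasDerivAt
    have comp (F : ℝ × ℝ → ℝ) (hF : ContDiffOn ℝ ∞ F W) :
        HasDerivAt (fun t => F (β t)) (Dx F u) 0 := by
      have := hasFDerivAt_of_contDiffOn h.isOpen hF hu
      rw [← hβ0] at this
      have := this.comp_hasDerivAt (0 : ℝ) hβ'
      rw [hβ0] at this
      exact this
    have hev : ∀ᶠ t in 𝓝 (0 : ℝ), dX X (inv (γ t)) = dX X (β t) := by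
      filter_upwards [hβγ] with t ht
      rw [ht.2, hinv _ ht.1]
    refine covDerivAlong_eq hγ.pos (h.horizontal u hu) ?_ ?_
    · refine ((comp _ hd.fst).congr_of_eventuallyEq
        (hev.mono fun t ht => congrArg Prod.fst ht)).congr_deriv ?_
      exact (hasDx h.isOpen hd.fst hu).unique (h.curvature_fst u hu)
    · refine ((comp _ hd.snd.fst).congr_of_eventuallyEq
        (hev.mono fun t ht => congrArg (fun P : H1 => P.2.1) ht)).congr_deriv ?_
      exact (hasDx h.isOpen hd.snd.fst hu).unique (h.curvature_snd u hu)
  · rintro _ ⟨u, hu, rfl⟩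
    simp only [hinv u hu]
    rw [hchart.tangentPlane_eq hu,
      alpha_combination (h.horizontal u hu) (h.unit u hu) (h.transverse u hu) (h.alpha u hu)]
    exact ⟨(_, _), fderiv_eq_combination X u _⟩

/-- The frame coefficients of a solution of the structure equations. -/
theorem StructureEqs.hasFrameCoeffs (h : StructureEqs c α W X) :
    HasFrameCoeffs α W X (fun u => 1 / √(1 + α u ^ 2) * (shiftY X u / contactY X u))
      (fun u => 1 / √(1 + α u ^ 2) * (1 / contactY X u)) := by
  intro u hu
  rw [alpha_combination (h.horizontal u hu) (h.unit u hu) (h.transverse u hu) (h.alpha u hu),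
    smul_add, smul_smul, smul_smul]
  rfl

theorem sqrt_one_add_sq_pos (x : ℝ) : 0 < √(1 + x ^ 2) := Real.sqrt_pos.2 (by positivity)

/-- Any frame coefficients are determined by the structure equations. -/
theorem StructureEqs.frameCoeffs_eq (h : StructureEqs c α W X) {a b : ℝ × ℝ → ℝ}
    (hab : HasFrameCoeffs α W X a b) {u : ℝ × ℝ} (hu : u ∈ W) :
    √(1 + α u ^ 2) * b u * contactY X u = 1 ∧ a u = b u * shiftY X u := by
  have hs := sqrt_one_add_sq_pos (α u)
  have h1 := congrArg (fun P : H1 => √(1 + α u ^ 2) • P) (hab u hu)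
  simp only [smul_add, smul_smul] at h1
  rw [← mul_assoc, mul_one_div_cancel hs.ne', one_mul, one_smul] at h1
  obtain ⟨e1, -, e3⟩ := alpha_eq_of_combination (h.horizontal u hu) (h.unit u hu) h1
  refine ⟨e1, mul_left_cancel₀ hs.ne' ?_⟩
  rw [e3, shiftY]
  ring

/-- Here a/b = n and 1/b² = (1 + α²)m² = m² + w², while |X_y|² = n² + w² + m². -/
theorem StructureEqs.hasInducedMetric (h : StructureEqs c α W X) {a b : ℝ × ℝ → ℝ}
    (hab : HasFrameCoeffs α W X a b) : HasInducedMetric W X a b := by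
  intro u hu
  obtain ⟨hb, ha⟩ := h.frameCoeffs_eq hab hu
  have hs := sqrt_one_add_sq_pos (α u)
  have hb0 : b u ≠ 0 := by rintro h0; simp [h0] at hb
  have hn : a u / b u = shiftY X u := by rw [ha]; field_simp
  have hbi : 1 / b u = √(1 + α u ^ 2) * contactY X u := by
    rw [div_eq_iff hb0]; linarith
  have hh := h.horizontal u hu
  have hα : α u * contactY X u = normalY X u := h.alpha u hu
  have hu1 := h.unit u hu
  refine ⟨?_, ?_, ?_⟩
  · rw [adaptedMetric_self_of_horizontal hh]
    exact hu1
  · rw [hn, shiftY, adaptedMetric, hh]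
    ring
  · rw [hn, hbi, mul_pow, Real.sq_sqrt (by positivity), add_mul, ← mul_pow, hα, adaptedMetric,
      shiftY, normalY, contactY]
    linear_combination (-((dY X u).1 ^ 2 + (dY X u).2.1 ^ 2)) * hu1

end Realize

/-! ### Antiderivatives with respect to the first variable -/

open MeasureTheory in
/-- A smooth function of two variables has locally a smooth antiderivative in the first
variable. -/
theorem exists_isAntiderivX {U : Set (ℝ × ℝ)} {f : ℝ × ℝ → ℝ} {u₀ : ℝ × ℝ} (hU : IsOpen U)
    (hf : ContDiffOn ℝ ∞ f U) (hu : u₀ ∈ U) :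
    ∃ V ⊆ U, IsOpen V ∧ u₀ ∈ V ∧ ∃ F, IsAntiderivX f F V := by
  obtain ⟨R, hR, hRU⟩ := Metric.nhds_basis_closedBall.mem_iff.1 (hU.mem_nhds hu)
  -- Cutting off makes the function globally smooth with bounded x-support, so one can integrate
  -- from -∞; nothing changes on the ball of radius `R / 2`.
  let χ : ContDiffBump u₀ := ⟨R / 2, R, by positivity, by linarith⟩
  let φ : ℝ × ℝ → ℝ := fun u => χ u * f u
  have hφ : ContDiff ℝ ∞ φ := by
    refine contDiff_iff_contDiffAt.2 fun u => ?_
    by_cases hu : u ∈ tsupport χ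
    · rw [χ.tsupport_eq] at hu
      exact χ.contDiffAt.mul (hf.contDiffAt (hU.mem_nhds (hRU hu)))
    · refine contDiffAt_const (c := (0 : ℝ)) |>.congr_of_eventuallyEq ?_
      filter_upwards [notMem_tsupport_iff_eventuallyEq.1 hu] with v hv
      simp [φ, hv]
  have hφ0 (y x : ℝ) (hx : x ∉ Metric.closedBall u₀.1 R) : φ (x, y) = 0 := by
    have : χ (x, y) = 0 := χ.zero_of_le_dist (by
      rw [Metric.mem_closedBall, not_le] at hx
      exact hx.le.trans (le_max_left _ _))
    simp [φ, this]
  have hφint (y : ℝ) : Integrable (fun x => φ (x, y)) :=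
    (hφ.continuous.comp (Continuous.prodMk_left y)).integrable_of_hasCompactSupport
      (HasCompactSupport.intro (isCompact_closedBall u₀.1 R) fun x hx => hφ0 y x hx)
  -- The integral from -∞ is convolution with the Heaviside function, so joint smoothness follows
  -- from smoothness of convolutions with a parameter.
  have hsm := contDiffOn_convolution_right_with_param (𝕜 := ℝ) (μ := (volume : Measure ℝ))
    (f := indicator (Ici (0 : ℝ)) fun _ => (1 : ℝ)) (n := ⊤) (ContinuousLinearMap.mul ℝ ℝ)
    (g := fun y x : ℝ => φ (x, y)) (s := univ) isOpen_univ (isCompact_closedBall u₀.1 R)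
    (fun y x _ hx => hφ0 y x hx) ((locallyIntegrable_const 1).indicator measurableSet_Ici)
    (hφ.comp (contDiff_snd.prodMk contDiff_fst)).contDiffOn
  rw [univ_prod_univ, contDiffOn_univ] at hsm
  let F : ℝ × ℝ → ℝ := fun u => ∫ s in Iic u.1, φ (s, u.2)
  have hF : ContDiff ℝ ∞ F := by
    have h := hsm.comp (contDiff_snd.prodMk contDiff_fst : ContDiff ℝ ∞ fun u : ℝ × ℝ => (u.2, u.1))
    convert h using 1
    ext u
    simp only [F, Function.comp_apply, convolution_def, ContinuousLinearMap.mul_apply']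
    rw [← integral_indicator measurableSet_Iic, ← integral_sub_left_eq_self _ _ u.1]
    congr 1
    ext t
    simp [indicator]
  have hFx (u : ℝ × ℝ) : HasDx F (φ u) u := by
    have hc : Continuous fun x => φ (x, u.2) := hφ.continuous.comp (Continuous.prodMk_left u.2)
    have h1 : HasDerivAt (fun t => F u + ∫ s in u.1..t, φ (s, u.2)) (φ u) u.1 :=
      (intervalIntegral.integral_hasDerivAt_right (hc.intervalIntegrable _ _)
        (hc.stronglyMeasurableAtFilter _ _) hc.continuousAt).const_add _
    refine h1.congr_of_eventuallyEq (Eventually.of_forall fun t => ?_)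
    have := intervalIntegral.integral_Iic_sub_Iic (a := u.1) (b := t) (hφint u.2).integrableOn
      (hφint u.2).integrableOn
    simp only [F]
    linarith
  refine ⟨Metric.ball u₀ (R / 2), fun u hu => hRU (Metric.ball_subset_closedBall
    (Metric.ball_subset_ball (by linarith) hu)), Metric.isOpen_ball,
    Metric.mem_ball_self (by positivity), F, hF.contDiffOn, fun u hu => (hFx u).congr_deriv ?_⟩
  have : χ u = 1 := χ.one_of_mem_closedBall (Metric.ball_subset_closedBall hu)
  simp [φ, this]

/-! ### Integration of the structure equations -/

section Integrate

variable {c : ℝ} {α : ℝ × ℝ → ℝ} {U B : Set (ℝ × ℝ)} {X : ℝ × ℝ → H1}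

theorem IsLienardSolution.mono (h : IsLienardSolution c U α) (hBU : B ⊆ U) :
    IsLienardSolution c B α :=
  ⟨h.1.mono hBU, fun u hu => h.2 u (hBU hu)⟩

theorem IsLienardSolution.Dx_Dx (h : IsLienardSolution c U α) (hU : IsOpen U) {u : ℝ × ℝ}
    (hu : u ∈ U) :
    Dx (Dx α) u + 6 * α u * Dx α u + 4 * α u ^ 3 + c ^ 2 * α u = 0 := by
  have hpx (v : ℝ × ℝ) (hv : v ∈ U) : partialX α v = Dx α v := (hasDx hU h.1 hv).deriv
  have hpxx : partialX (partialX α) u = Dx (Dx α) u :=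
    (HasDx.congr (hasDx hU (contDiffOn_Dx hU h.1) hu) hU hu hpx).deriv
  rw [← hpxx, ← hpx u hu]
  exact h.2 u hu

theorem dX_mk {f g z : ℝ × ℝ → ℝ} (hU : IsOpen U) (hf : ContDiffOn ℝ ∞ f U)
    (hg : ContDiffOn ℝ ∞ g U) (hz : ContDiffOn ℝ ∞ z U) {u : ℝ × ℝ} (hu : u ∈ U) :
    dX (fun v => ((f v, g v, z v) : H1)) u = (Dx f u, Dx g u, Dx z u) ∧
      dY (fun v => ((f v, g v, z v) : H1)) u = (Dy f u, Dy g u, Dy z u) := by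
  have h := (hasFDerivAt_of_contDiffOn hU hf hu).prodMk
    ((hasFDerivAt_of_contDiffOn hU hg hu).prodMk (hasFDerivAt_of_contDiffOn hU hz hu))
  rw [dX, dY, h.fderiv]
  exact ⟨rfl, rfl⟩

/-- The structure equations can be integrated on a convex open set. -/
theorem exists_structureEqs (hB : IsOpen B) (hc : Convex ℝ B) (hα : IsLienardSolution c B α)
    {m n : ℝ × ℝ → ℝ} (hm : ContDiffOn ℝ ∞ m B) (hn : ContDiffOn ℝ ∞ n B)
    (hm0 : ∀ u ∈ B, m u ≠ 0) (hmx : ∀ u ∈ B, HasDx m (2 * (α u * m u)) u)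
    (hnx : ∀ u ∈ B, HasDx n (-(c * (α u * m u))) u) :
    ∃ X, StructureEqs c α B X ∧ ∀ u ∈ B, contactY X u = m u ∧ shiftY X u = n u := by
  let w : ℝ × ℝ → ℝ := fun u => α u * m u
  -- The forced value of θ_y, namely w_x - cn.
  let φ : ℝ × ℝ → ℝ := fun u => Dx α u * m u + α u * (2 * (α u * m u)) - c * n u
  have hαx := contDiffOn_Dx hB hα.1
  have hw : ContDiffOn ℝ ∞ w B := hα.1.mul hm
  have hφ : ContDiffOn ℝ ∞ φ B :=
    ((hαx.mul hm).add (hα.1.mul (contDiffOn_const.mul hw))).sub (contDiffOn_const.mul hn)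
  have hwx (u : ℝ × ℝ) (hu : u ∈ B) : HasDx w (φ u + c * n u) u :=
    ((hasDx hB hα.1 hu).mul (hmx u hu)).congr_deriv (by simp [φ])
  -- This is where the Liénard equation enters: it is the integrability condition for θ.
  have hφx (u : ℝ × ℝ) (hu : u ∈ B) : HasDx φ 0 u := by
    have h1 := (((hasDx hB hαx hu).mul (hmx u hu)).add ((hasDx hB hα.1 hu).mul
      (((hasDx hB hα.1 hu).mul (hmx u hu)).const_mul 2))).sub ((hnx u hu).const_mul c)
    refine HasDerivAt.congr_deriv h1 ?_
    simp only [Pi.mul_apply]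
    linear_combination m u * hα.Dx_Dx hB hu
  obtain ⟨θ, hθ, hθd⟩ := exists_primitive hB hc (P := fun _ => c) (Q := φ) (D := fun _ => 0)
    contDiffOn_const hφ (fun u _ => hasDerivAt_const _ _) hφx
  have hθx (u : ℝ × ℝ) (hu : u ∈ B) : HasDx θ c u :=
    (hasDx hB hθ hu).congr_deriv (hθd u hu).1
  have hθy (u : ℝ × ℝ) (hu : u ∈ B) : HasDy θ (φ u) u :=
    (hasDy hB hθ hu).congr_deriv (hθd u hu).2
  let p : ℝ × ℝ → ℝ := fun u => Real.cos (θ u)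
  let q : ℝ × ℝ → ℝ := fun u => Real.sin (θ u)
  have hp : ContDiffOn ℝ ∞ p B := hθ.cos
  have hq : ContDiffOn ℝ ∞ q B := hθ.sin
  have hpx (u : ℝ × ℝ) (hu : u ∈ B) : HasDx p (-(c * q u)) u :=
    (hθx u hu).cos.congr_deriv (by simp only [q]; ring)
  have hqx (u : ℝ × ℝ) (hu : u ∈ B) : HasDx q (c * p u) u :=
    (hθx u hu).sin.congr_deriv (by simp only [p]; ring)
  have hpy (u : ℝ × ℝ) (hu : u ∈ B) : HasDy p (-(φ u * q u)) u :=
    (hθy u hu).cos.congr_deriv (by simp only [q]; ring)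
  have hqy (u : ℝ × ℝ) (hu : u ∈ B) : HasDy q (φ u * p u) u :=
    (hθy u hu).sin.congr_deriv (by simp only [p]; ring)
  have hpq (u : ℝ × ℝ) : p u ^ 2 + q u ^ 2 = 1 := Real.cos_sq_add_sin_sq _
  -- The horizontal part of X_y must be -n X_x + w J X_x; `r` and `s` are its components.
  let r : ℝ × ℝ → ℝ := fun u => -(n u * p u) - w u * q u
  let s : ℝ × ℝ → ℝ := fun u => w u * p u - n u * q u
  have hr : ContDiffOn ℝ ∞ r B := ((hn.mul hp).neg).sub (hw.mul hq)
  have hs : ContDiffOn ℝ ∞ s B := (hw.mul hp).sub (hn.mul hq)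
  have hrx (u : ℝ × ℝ) (hu : u ∈ B) : HasDx r (-(φ u * q u)) u :=
    ((((hnx u hu).mul (hpx u hu)).neg).sub ((hwx u hu).mul (hqx u hu))).congr_deriv
      (by simp only [w]; ring)
  have hsx (u : ℝ × ℝ) (hu : u ∈ B) : HasDx s (φ u * p u) u :=
    (((hwx u hu).mul (hpx u hu)).sub ((hnx u hu).mul (hqx u hu))).congr_deriv
      (by simp only [w]; ring)
  obtain ⟨f, hf, hfd⟩ := exists_primitive hB hc hp hr hpy hrx
  obtain ⟨g, hg, hgd⟩ := exists_primitive hB hc hq hs hqy hsx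
  have hfx (u : ℝ × ℝ) (hu : u ∈ B) : HasDx f (p u) u := (hasDx hB hf hu).congr_deriv (hfd u hu).1
  have hfy (u : ℝ × ℝ) (hu : u ∈ B) : HasDy f (r u) u := (hasDy hB hf hu).congr_deriv (hfd u hu).2
  have hgx (u : ℝ × ℝ) (hu : u ∈ B) : HasDx g (q u) u := (hasDx hB hg hu).congr_deriv (hgd u hu).1
  have hgy (u : ℝ × ℝ) (hu : u ∈ B) : HasDy g (s u) u := (hasDy hB hg hu).congr_deriv (hgd u hu).2
  have hps (u : ℝ × ℝ) : p u * s u - q u * r u = w u := by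
    simp only [r, s]
    linear_combination w u * hpq u
  -- The form is dictated by Θ(X_x) = 0 and Θ(X_y) = m; it is closed because m_x = 2w.
  obtain ⟨z, hz, hzd⟩ := exists_primitive hB hc (P := fun u => g u * p u - f u * q u)
    (Q := fun u => m u + (g u * r u - f u * s u))
    (D := fun u => w u - φ u * (g u * q u + f u * p u))
    ((hg.mul hp).sub (hf.mul hq)) (hm.add ((hg.mul hr).sub (hf.mul hs)))
    (fun u hu => (((hgy u hu).mul (hpy u hu)).sub ((hfy u hu).mul (hqy u hu))).congr_deriv
      (by linear_combination hps u))
    (fun u hu => ((hmx u hu).add (((hgx u hu).mul (hrx u hu)).sub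
      ((hfx u hu).mul (hsx u hu)))).congr_deriv (by
        have := hps u
        simp only [w] at this ⊢
        linear_combination -this))
  have hdX (u : ℝ × ℝ) (hu : u ∈ B) : dX (fun v => ((f v, g v, z v) : H1)) u =
      (p u, q u, g u * p u - f u * q u) := by
    rw [(dX_mk hB hf hg hz hu).1, (hfd u hu).1, (hgd u hu).1, (hzd u hu).1]
  have hdY (u : ℝ × ℝ) (hu : u ∈ B) : dY (fun v => ((f v, g v, z v) : H1)) u =
      (r u, s u, m u + (g u * r u - f u * s u)) := by
    rw [(dX_mk hB hf hg hz hu).2, (hfd u hu).2, (hgd u hu).2, (hzd u hu).2]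
  have hcY (u : ℝ × ℝ) (hu : u ∈ B) :
      contactForm (f u, g u, z u) (dY (fun v => ((f v, g v, z v) : H1)) u) = m u := by
    rw [hdY u hu, contactForm_apply]
    ring
  refine ⟨fun v => (f v, g v, z v), ⟨hB, hf.prodMk (hg.prodMk hz), ?_, ?_, ?_, ?_, ?_, ?_⟩, ?_⟩
  · intro u hu
    rw [hdX u hu, contactForm_apply]
    ring
  · intro u hu
    rw [hdX u hu]
    exact hpq u
  · intro u hu
    rw [hdX u hu]
    exact HasDx.congr (hpx u hu) hB hu fun v hv => by rw [hdX v hv]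
  · intro u hu
    rw [hdX u hu]
    exact HasDx.congr (hqx u hu) hB hu fun v hv => by rw [hdX v hv]
  · intro u hu
    rw [hcY u hu]
    exact hm0 u hu
  · intro u hu
    rw [hcY u hu, hdX u hu, hdY u hu]
    exact (hps u).symm
  · intro u hu
    refine ⟨hcY u hu, ?_⟩
    rw [shiftY, hdX u hu, hdY u hu]
    simp only [r, s]
    linear_combination n u * hpq u

/-- Θ vanishes on X_x but not on X_y, and X_x ≠ 0. -/
theorem StructureEqs.injective_fderiv (h : StructureEqs c α U X) {u : ℝ × ℝ} (hu : u ∈ U) :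
    Function.Injective (fderiv ℝ X u) := by
  rw [injective_iff_map_eq_zero]
  intro z hz
  rw [fderiv_eq_combination] at hz
  have h1 := congrArg (contactForm (X u)) hz
  simp only [map_add, map_smul, h.horizontal u hu, smul_eq_mul, mul_zero, zero_add,
    map_zero] at h1
  have z2 : z.2 = 0 := (mul_eq_zero.1 h1).resolve_right (h.transverse u hu)
  rw [z2, zero_smul, add_zero] at hz
  have hne : dX X u ≠ 0 := fun h0 => by
    have := h.unit u hu
    rw [h0] at this
    simp at this
  exact Prod.ext ((smul_eq_zero.1 hz).resolve_right hne) z2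

theorem StructureEqs.mono (h : StructureEqs c α U X) (hB : IsOpen B) (hBU : B ⊆ U) :
    StructureEqs c α B X :=
  ⟨hB, h.smooth.mono hBU, fun u hu => h.horizontal u (hBU hu), fun u hu => h.unit u (hBU hu),
    fun u hu => h.curvature_fst u (hBU hu), fun u hu => h.curvature_snd u (hBU hu),
    fun u hu => h.transverse u (hBU hu), fun u hu => h.alpha u (hBU hu)⟩

theorem HasFrameCoeffs.congr {a b a' b' : ℝ × ℝ → ℝ} (h : HasFrameCoeffs α U X a b)
    (ha : ∀ u ∈ U, a' u = a u) (hb : ∀ u ∈ U, b' u = b u) : HasFrameCoeffs α U X a' b' :=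
  fun u hu => by rw [ha u hu, hb u hu]; exact h u hu

theorem AreAntiderivs.mono {E G : ℝ × ℝ → ℝ} (h : AreAntiderivs c α E G U) (hBU : B ⊆ U) :
    AreAntiderivs c α E G B :=
  ⟨⟨h.1.1.mono hBU, fun u hu => h.1.2 u (hBU hu)⟩, ⟨h.2.1.mono hBU, fun u hu => h.2.2 u (hBU hu)⟩⟩

/-- Antiderivatives as in the formulas for the metric exist locally. -/
theorem exists_areAntiderivs (hU : IsOpen U) (hα : ContDiffOn ℝ ∞ α U) {u₀ : ℝ × ℝ}
    (hu : u₀ ∈ U) : ∃ V ⊆ U, IsOpen V ∧ u₀ ∈ V ∧ ∃ E G, AreAntiderivs c α E G V := by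
  obtain ⟨V, hVU, hV, huV, E, hE⟩ := exists_isAntiderivX hU
    ((contDiffOn_const (c := (2 : ℝ))).mul hα) hu
  obtain ⟨W, hWV, hW, huW, G, hG⟩ := exists_isAntiderivX hV
    (((contDiffOn_const (c := c)).mul (hα.mono hVU)).mul hE.1.exp) huV
  exact ⟨W, hWV.trans hVU, hW, huW, E, G, ⟨hE.1.mono hWV, fun u hu => hE.2 u (hWV hu)⟩, hG⟩

/-- Every solution, together with every pair of functions `k`, `h`, is realized locally. -/
theorem exists_isRealization {V : Set (ℝ × ℝ)} (hV : IsOpen V) (hα : IsLienardSolution c V α)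
    {u₀ : ℝ × ℝ} (hu : u₀ ∈ V) {E G : ℝ × ℝ → ℝ} (hEG : AreAntiderivs c α E G V)
    {k h : ℝ → ℝ} (hk : ContDiffOn ℝ ∞ k (Prod.snd '' V))
    (hh : ContDiffOn ℝ ∞ h (Prod.snd '' V)) :
    ∃ W ⊆ V, IsOpen W ∧ u₀ ∈ W ∧ ∃ X, IsRealization c α W X ∧
      HasFrameCoeffs α W X (coeffA α E G h) (coeffB α E k) ∧
      HasInducedMetric W X (coeffA α E G h) (coeffB α E k) := by
  obtain ⟨R, hR, hRV⟩ := Metric.isOpen_iff.1 hV u₀ hu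
  let B := Metric.ball u₀ R
  have hk' : ContDiffOn ℝ ∞ (fun u : ℝ × ℝ => k u.2) B :=
    hk.comp contDiffOn_snd fun u hu => ⟨u, hRV hu, rfl⟩
  have hh' : ContDiffOn ℝ ∞ (fun u : ℝ × ℝ => h u.2) B :=
    hh.comp contDiffOn_snd fun u hu => ⟨u, hRV hu, rfl⟩
  obtain ⟨hE, hG⟩ := hEG.mono hRV
  -- Obtained by solving a = n / (m √(1+α²)) and b = 1 / (m √(1+α²)) for m and n.
  let m : ℝ × ℝ → ℝ := fun u => Real.exp (E u) * Real.exp (-k u.2)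
  let n : ℝ × ℝ → ℝ := fun u => (h u.2 - G u) * Real.exp (-k u.2)
  have hm0 (u : ℝ × ℝ) : m u ≠ 0 := by positivity
  have hmx (u : ℝ × ℝ) (hu : u ∈ B) : HasDx m (2 * (α u * m u)) u :=
    ((hE.2 u hu).exp.mul_const (Real.exp (-k u.2))).congr_deriv (by simp only [m]; ring)
  have hnx (u : ℝ × ℝ) (hu : u ∈ B) : HasDx n (-(c * (α u * m u))) u :=
    (((hG.2 u hu).const_sub (h u.2)).mul_const (Real.exp (-k u.2))).congr_deriv
      (by simp only [m]; ring)
  obtain ⟨X, hX, hXmn⟩ := exists_structureEqs (B := B) (m := m) (n := n) Metric.isOpen_ball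
    (convex_ball u₀ R) (hα.mono hRV) (hE.1.exp.mul hk'.neg.exp)
    ((hh'.sub hG.1).mul hk'.neg.exp) (fun u _ => hm0 u) hmx hnx
  have hu₀ : u₀ ∈ B := Metric.mem_ball_self hR
  obtain ⟨W, hWB, huW, hW⟩ :=
    exists_isSmoothEmbedding Metric.isOpen_ball hX.smooth hu₀ (hX.injective_fderiv hu₀)
  have hXW := hX.mono hW.isOpen hWB
  have hcoef : HasFrameCoeffs α W X (coeffA α E G h) (coeffB α E k) := by
    refine hXW.hasFrameCoeffs.congr (fun u hu => ?_) fun u hu => ?_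
    · rw [(hXmn u (hWB hu)).1, (hXmn u (hWB hu)).2, coeffA]
      simp only [m, n, Real.exp_neg]
      field_simp
    · rw [(hXmn u (hWB hu)).1, coeffB]
      simp only [m, Real.exp_neg]
      field_simp
  exact ⟨W, hWB.trans hRV, hW.isOpen, huW, X, hXW.isRealization hW, hcoef,
    hXW.hasInducedMetric hcoef⟩

end Integrate

/-! ### The metric determines `k` and `h` -/

section Metric

variable {c : ℝ} {α : ℝ × ℝ → ℝ} {V : Set (ℝ × ℝ)} {X : ℝ × ℝ → H1}

/-- A smooth function with vanishing first partial derivative, on an open set with connected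
sections, is a smooth function of the second variable. -/
theorem exists_eq_comp_snd {F : ℝ × ℝ → ℝ} (hV : IsOpen V)
    (hsec : ∀ y : ℝ, IsPreconnected {x : ℝ | (x, y) ∈ V}) (hF : ContDiffOn ℝ ∞ F V)
    (hx : ∀ u ∈ V, HasDx F 0 u) :
    ∃ k : ℝ → ℝ, ContDiffOn ℝ ∞ k (Prod.snd '' V) ∧ ∀ u ∈ V, k u.2 = F u := by
  classical
  have hconst (x x' y : ℝ) (h : (x, y) ∈ V) (h' : (x', y) ∈ V) : F (x, y) = F (x', y) := by
    have ho : IsOpen {x : ℝ | (x, y) ∈ V} := hV.preimage (Continuous.prodMk_left y)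
    exact ho.is_const_of_deriv_eq_zero (f := fun t => F (t, y)) (hsec y)
      (fun t ht => (hx (t, y) ht).differentiableAt.differentiableWithinAt)
      (fun t ht => (hx (t, y) ht).deriv) h h'
  -- The choice of x is immaterial on connected sections; smoothness is read off along a vertical
  -- line through any point.
  let k : ℝ → ℝ := fun y => if h : ∃ x, (x, y) ∈ V then F (h.choose, y) else 0
  have hk (u : ℝ × ℝ) (hu : u ∈ V) : k u.2 = F u := by
    have h : ∃ x, (x, u.2) ∈ V := ⟨u.1, hu⟩
    simp only [k, dif_pos h]
    exact hconst _ _ _ h.choose_spec hu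
  refine ⟨k, ?_, hk⟩
  rintro _ ⟨u, hu, rfl⟩
  have h1 : ContDiffAt ℝ ∞ (fun y => F (u.1, y)) u.2 :=
    (hF.contDiffAt (hV.mem_nhds hu)).comp u.2 (contDiff_const.prodMk contDiff_id).contDiffAt
  exact (h1.congr_of_eventuallyEq
    ((slice_snd_mem hV hu).mono fun y hy => hk (u.1, y) hy)).contDiffWithinAt

theorem coeffA_inj {E G : ℝ × ℝ → ℝ} {h h' : ℝ → ℝ} {u : ℝ × ℝ}
    (hh : coeffA α E G h u = coeffA α E G h' u) : h u.2 = h' u.2 := by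
  have hs := sqrt_one_add_sq_pos (α u)
  have := mul_left_cancel₀ (div_pos (Real.exp_pos (-E u)) hs).ne' hh
  linarith

theorem coeffB_inj {E : ℝ × ℝ → ℝ} {k k' : ℝ → ℝ} {u : ℝ × ℝ}
    (hk : coeffB α E k u = coeffB α E k' u) : k u.2 = k' u.2 := by
  have hs := sqrt_one_add_sq_pos (α u)
  exact Real.exp_injective (mul_right_cancel₀ (div_pos (Real.exp_pos (-E u)) hs).ne' hk)

/-- With μ = m e^{-E} and ν = n + μG, the structure equations give μ_x = ν_x = 0. Connected sections
make both functions of y, and then h = ν/μ and k = -log|μ|. -/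
theorem StructureEqs.exists_frameCoeffs (H : StructureEqs c α V X)
    (hsec : ∀ y : ℝ, IsPreconnected {x : ℝ | (x, y) ∈ V}) :
    ∃ a b : ℝ × ℝ → ℝ, ContDiffOn ℝ ∞ a V ∧ ContDiffOn ℝ ∞ b V ∧ (∀ u ∈ V, b u ≠ 0) ∧
      HasFrameCoeffs α V X a b ∧ HasInducedMetric V X a b ∧
      ∀ E G, AreAntiderivs c α E G V →
        ∃ k h : ℝ → ℝ,
          ContDiffOn ℝ ∞ k (Prod.snd '' V) ∧ ContDiffOn ℝ ∞ h (Prod.snd '' V) ∧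
          (∀ u ∈ V, a u = coeffA α E G h u ∧ |b u| = coeffB α E k u) ∧
          ∀ k' h' : ℝ → ℝ,
            (∀ u ∈ V, a u = coeffA α E G h' u ∧ |b u| = coeffB α E k' u) →
            EqOn k' k (Prod.snd '' V) ∧ EqOn h' h (Prod.snd '' V) := by
  have hm := H.contDiffOn_contactY
  have hn := H.contDiffOn_shiftY
  have hm0 (u : ℝ × ℝ) (hu : u ∈ V) : contactY X u ≠ 0 := H.contactY_ne_zero hu
  have hsq : ContDiffOn ℝ ∞ (fun u => 1 / √(1 + α u ^ 2)) V :=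
    contDiffOn_const.div ((contDiffOn_const.add (H.contDiffOn_alpha.pow 2)).sqrt
      fun u _ => by positivity) fun u _ => (sqrt_one_add_sq_pos (α u)).ne'
  refine ⟨_, _, hsq.mul (hn.div hm hm0), hsq.mul (contDiffOn_const.div hm hm0), ?_,
    H.hasFrameCoeffs, H.hasInducedMetric H.hasFrameCoeffs, ?_⟩
  · intro u hu
    exact mul_ne_zero (one_div_pos.2 (sqrt_one_add_sq_pos (α u))).ne' (one_div_ne_zero (hm0 u hu))
  intro E G hEG
  obtain ⟨hE, hG⟩ := hEG
  let μ : ℝ × ℝ → ℝ := fun u => contactY X u * Real.exp (-E u)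
  have hμ : ContDiffOn ℝ ∞ μ V := hm.mul hE.1.neg.exp
  have hμx (u : ℝ × ℝ) (hu : u ∈ V) : HasDx μ 0 u :=
    ((H.hasDx_contactY hu).mul (hE.2 u hu).neg.exp).congr_deriv (by simp only [Pi.neg_apply]; ring)
  have hμ0 (u : ℝ × ℝ) (hu : u ∈ V) : μ u ≠ 0 := mul_ne_zero (hm0 u hu) (Real.exp_ne_zero _)
  have hμE (u : ℝ × ℝ) : contactY X u = μ u * Real.exp (E u) := by
    simp only [μ]
    rw [mul_assoc, ← Real.exp_add]
    simp
  let ν : ℝ × ℝ → ℝ := fun u => shiftY X u + μ u * G u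
  have hν : ContDiffOn ℝ ∞ ν V := hn.add (hμ.mul hG.1)
  have hνx (u : ℝ × ℝ) (hu : u ∈ V) : HasDx ν 0 u :=
    ((H.hasDx_shiftY hu).add ((hμx u hu).mul (hG.2 u hu))).congr_deriv (by
      rw [hμE u]; ring)
  obtain ⟨μ₀, hμ₀, hμ₀e⟩ := exists_eq_comp_snd H.isOpen hsec hμ hμx
  obtain ⟨ν₀, hν₀, hν₀e⟩ := exists_eq_comp_snd H.isOpen hsec hν hνx
  have hμ₀0 (y : ℝ) (hy : y ∈ Prod.snd '' V) : μ₀ y ≠ 0 := by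
    obtain ⟨u, hu, rfl⟩ := hy
    rw [hμ₀e u hu]
    exact hμ0 u hu
  have key (u : ℝ × ℝ) (hu : u ∈ V) :
      1 / √(1 + α u ^ 2) * (shiftY X u / contactY X u)
        = coeffA α E G (fun y => ν₀ y / μ₀ y) u ∧
      -- `Real.log` is log of the absolute value, so no sign is assumed for `μ₀`, which may differ
      -- between components of `V`.
      |1 / √(1 + α u ^ 2) * (1 / contactY X u)| = coeffB α E (fun y => -Real.log (μ₀ y)) u := by
    have hs := sqrt_one_add_sq_pos (α u)
    have h0 := hμ0 u hu
    constructor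
    · simp only [coeffA]
      rw [hμ₀e u hu, hν₀e u hu, hμE u, Real.exp_neg]
      simp only [ν]
      field_simp
      ring
    · simp only [coeffB]
      rw [hμ₀e u hu, hμE u, Real.exp_neg, Real.exp_neg, ← Real.log_abs,
        Real.exp_log (abs_pos.2 h0), abs_mul, abs_div, abs_div, abs_mul, abs_one,
        abs_of_pos hs, Real.abs_exp]
      field_simp
  refine ⟨fun y => -Real.log (μ₀ y), fun y => ν₀ y / μ₀ y, (hμ₀.log hμ₀0).neg, hν₀.div hμ₀ hμ₀0,
    key, fun k' h' hkh => ⟨?_, ?_⟩⟩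
  · rintro _ ⟨u, hu, rfl⟩
    exact coeffB_inj ((hkh u hu).2.symm.trans (key u hu).2)
  · rintro _ ⟨u, hu, rfl⟩
    exact coeffA_inj ((hkh u hu).1.symm.trans (key u hu).1)

end Metric

/-! ### Rigid motions and uniqueness -/

/-- A rotation about the `z`-axis with matrix `(ρ, -κ; κ, ρ)`, followed by a left translation. -/
def motionFun (ρ κ A B C : ℝ) (P : H1) : H1 :=
  (ρ * P.1 - κ * P.2.1 + A, κ * P.1 + ρ * P.2.1 + B,
    P.2.2 + C + B * (ρ * P.1 - κ * P.2.1) - A * (κ * P.1 + ρ * P.2.1))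

theorem contDiff_motionFun (ρ κ A B C : ℝ) : ContDiff ℝ ∞ (motionFun ρ κ A B C) := by
  unfold motionFun
  fun_prop

/-- The rigid motion `motionFun` as an equivalence. -/
def motion (ρ κ A B C : ℝ) (h : ρ ^ 2 + κ ^ 2 = 1) : H1 ≃ H1 where
  toFun := motionFun ρ κ A B C
  -- The opposite rotation, with the translation vector (A, B) turned back and negated.
  invFun := motionFun ρ (-κ) (-(ρ * A + κ * B)) (-(ρ * B - κ * A)) (-C)
  left_inv P := by
    refine Prod.ext ?_ (Prod.ext ?_ ?_) <;> simp only [motionFun]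
    · linear_combination P.1 * h
    · linear_combination P.2.1 * h
    · linear_combination (κ * A * P.1 + ρ * A * P.2.1 - B * ρ * P.1 + B * κ * P.2.1) * h
  right_inv P := by
    refine Prod.ext ?_ (Prod.ext ?_ ?_) <;> simp only [motionFun]
    · linear_combination (P.1 - A) * h
    · linear_combination (P.2.1 - B) * h
    · ring

theorem fderiv_motionFun (ρ κ A B C : ℝ) (P v : H1) :
    fderiv ℝ (motionFun ρ κ A B C) P v = (ρ * v.1 - κ * v.2.1, κ * v.1 + ρ * v.2.1,
      v.2.2 + B * (ρ * v.1 - κ * v.2.1) - A * (κ * v.1 + ρ * v.2.1)) := by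
  have hx : HasFDerivAt (fun P : H1 => P.1) coordX P := coordX.hasFDerivAt
  have hy : HasFDerivAt (fun P : H1 => P.2.1) coordY P := coordY.hasFDerivAt
  have hz : HasFDerivAt (fun P : H1 => P.2.2) coordZ P := coordZ.hasFDerivAt
  have h1 := (hx.const_mul ρ).sub (hy.const_mul κ)
  have h2 := (hx.const_mul κ).add (hy.const_mul ρ)
  have h := (h1.add_const A).prodMk ((h2.add_const B).prodMk
    (((hz.add_const C).add (h1.const_mul B)).sub (h2.const_mul A)))
  have h' : HasFDerivAt (motionFun ρ κ A B C) _ P := h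
  rw [h'.fderiv]
  rfl

theorem isRigidMotion_motion (ρ κ A B C : ℝ) (h : ρ ^ 2 + κ ^ 2 = 1) :
    IsRigidMotion (motion ρ κ A B C h) where
  smooth := contDiff_motionFun _ _ _ _ _
  smooth_symm := contDiff_motionFun _ _ _ _ _
  preserves_contactForm P v := by
    change contactForm (motionFun ρ κ A B C P) (fderiv ℝ (motionFun ρ κ A B C) P v) = _
    rw [fderiv_motionFun, contactForm_apply, contactForm_apply]
    simp only [motionFun]
    linear_combination (P.1 * v.2.1 - P.2.1 * v.1) * h
  preserves_J P v hv := by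
    change fderiv ℝ (motionFun ρ κ A B C) P (cxJ P v) =
      cxJ (motionFun ρ κ A B C P) (fderiv ℝ (motionFun ρ κ A B C) P v)
    rw [fderiv_motionFun, fderiv_motionFun]
    refine Prod.ext ?_ (Prod.ext ?_ ?_)
    · simp [cxJ, frame1, frame2]; ring
    · simp [cxJ, frame1, frame2]; ring
    · simp [cxJ, frame1, frame2, motionFun]
      linear_combination (P.1 * v.1 + P.2.1 * v.2.1) * h

section Uniqueness

variable {c : ℝ} {α a b : ℝ × ℝ → ℝ} {V : Set (ℝ × ℝ)} {X X' : ℝ × ℝ → H1} {u : ℝ × ℝ}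

/-- The derivative `∂/∂y` in terms of the invariants. -/
theorem StructureEqs.dY_eq (H : StructureEqs c α V X) (hu : u ∈ V) :
    (dY X u).1 = -(shiftY X u * (dX X u).1) - normalY X u * (dX X u).2.1 ∧
    (dY X u).2.1 = normalY X u * (dX X u).1 - shiftY X u * (dX X u).2.1 ∧
    (dY X u).2.2 = contactY X u + ((X u).2.1 * (dY X u).1 - (X u).1 * (dY X u).2.1) := by
  refine ⟨?_, ?_, ?_⟩
  · rw [shiftY, normalY]
    linear_combination (-(dY X u).1) * H.unit u hu
  · rw [shiftY, normalY]
    linear_combination (-(dY X u).2.1) * H.unit u hu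
  · rw [contactY, contactForm_apply]
    ring

/-- Solutions of the structure equations with the same invariants differ by a rigid motion. -/
theorem StructureEqs.exists_rigidMotion (hV : IsPreconnected V) (H : StructureEqs c α V X)
    (H' : StructureEqs c α V X') (hm : ∀ u ∈ V, contactY X' u = contactY X u)
    (hn : ∀ u ∈ V, shiftY X' u = shiftY X u) :
    ∃ Φ : H1 ≃ H1, IsRigidMotion Φ ∧ ∀ u ∈ V, X' u = Φ (X u) := by
  have hw (u : ℝ × ℝ) (hu : u ∈ V) : normalY X' u = normalY X u := by
    rw [H.normalY_eq hu, H'.normalY_eq hu, hm u hu]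
  -- The angular speed is determined by the other invariants, as w_x - cn.
  have hφ (u : ℝ × ℝ) (hu : u ∈ V) : angleY X' u = angleY X u := by
    have h1 : HasDx (normalY X') _ u := HasDx.congr (H.hasDx_normalY hu) H.isOpen hu hw
    have h2 := h1.unique (H'.hasDx_normalY hu)
    rw [hn u hu] at h2
    linarith
  rcases V.eq_empty_or_nonempty with rfl | ⟨u₀, hu₀⟩
  · exact ⟨_, isRigidMotion_motion 1 0 0 0 0 (by norm_num), by simp⟩
  have hd := contDiffOn_dX H.isOpen H.smooth
  have hd' := contDiffOn_dX H'.isOpen H'.smooth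
  have py (u : ℝ × ℝ) (hu : u ∈ V) :
      HasDy (fun v => (dX X v).1) (-(angleY X u * (dX X u).2.1)) u :=
    (H.hasDy_dX_fst hu).congr_deriv (H.Dy_dX_fst hu)
  have qy (u : ℝ × ℝ) (hu : u ∈ V) :
      HasDy (fun v => (dX X v).2.1) (angleY X u * (dX X u).1) u :=
    (H.hasDy_dX_snd hu).congr_deriv (H.Dy_dX_snd hu)
  have py' (u : ℝ × ℝ) (hu : u ∈ V) :
      HasDy (fun v => (dX X' v).1) (-(angleY X u * (dX X' u).2.1)) u :=
    (H'.hasDy_dX_fst hu).congr_deriv (by rw [H'.Dy_dX_fst hu, hφ u hu])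
  have qy' (u : ℝ × ℝ) (hu : u ∈ V) :
      HasDy (fun v => (dX X' v).2.1) (angleY X u * (dX X' u).1) u :=
    (H'.hasDy_dX_snd hu).congr_deriv (by rw [H'.Dy_dX_snd hu, hφ u hu])
  -- `ρ` and `κ` are the cosine and sine of the angle from X_x to X'_x, constant because both
  -- vectors turn at the same rates in x and in y.
  obtain ⟨ρ, hρ⟩ := exists_const_of_slices
    (F := fun v => (dX X v).1 * (dX X' v).1 + (dX X v).2.1 * (dX X' v).2.1) H.isOpen hV
    ((hd.fst.mul hd'.fst).add (hd.snd.fst.mul hd'.snd.fst))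
    (fun u hu => (((H.curvature_fst u hu).mul (H'.curvature_fst u hu)).add
      ((H.curvature_snd u hu).mul (H'.curvature_snd u hu))).congr_deriv (by ring))
    (fun u hu => (((py u hu).mul (py' u hu)).add ((qy u hu).mul (qy' u hu))).congr_deriv (by ring))
  obtain ⟨κ, hκ⟩ := exists_const_of_slices
    (F := fun v => (dX X v).1 * (dX X' v).2.1 - (dX X v).2.1 * (dX X' v).1) H.isOpen hV
    ((hd.fst.mul hd'.snd.fst).sub (hd.snd.fst.mul hd'.fst))
    (fun u hu => (((H.curvature_fst u hu).mul (H'.curvature_snd u hu)).sub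
      ((H.curvature_snd u hu).mul (H'.curvature_fst u hu))).congr_deriv (by ring))
    (fun u hu => (((py u hu).mul (qy' u hu)).sub ((qy u hu).mul (py' u hu))).congr_deriv (by ring))
  have hrot : ρ ^ 2 + κ ^ 2 = 1 := by
    rw [← hρ u₀ hu₀, ← hκ u₀ hu₀]
    have e1 := H.unit u₀ hu₀
    have e2 := H'.unit u₀ hu₀
    linear_combination ((dX X' u₀).1 ^ 2 + (dX X' u₀).2.1 ^ 2) * e1 + e2
  have ep (u : ℝ × ℝ) (hu : u ∈ V) : (dX X' u).1 = ρ * (dX X u).1 - κ * (dX X u).2.1 := by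
    rw [← hρ u hu, ← hκ u hu]
    linear_combination (-(dX X' u).1) * H.unit u hu
  have eq (u : ℝ × ℝ) (hu : u ∈ V) : (dX X' u).2.1 = κ * (dX X u).1 + ρ * (dX X u).2.1 := by
    rw [← hρ u hu, ← hκ u hu]
    linear_combination (-(dX X' u).2.1) * H.unit u hu
  have er (u : ℝ × ℝ) (hu : u ∈ V) : (dY X' u).1 = ρ * (dY X u).1 - κ * (dY X u).2.1 := by
    rw [(H'.dY_eq hu).1, hn u hu, hw u hu, ep u hu, eq u hu, (H.dY_eq hu).1, (H.dY_eq hu).2.1]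
    ring
  have es (u : ℝ × ℝ) (hu : u ∈ V) : (dY X' u).2.1 = κ * (dY X u).1 + ρ * (dY X u).2.1 := by
    rw [(H'.dY_eq hu).2.1, hn u hu, hw u hu, ep u hu, eq u hu, (H.dY_eq hu).1, (H.dY_eq hu).2.1]
    ring
  have fx (u : ℝ × ℝ) (hu : u ∈ V) := hasDx_component H.isOpen H.smooth hu coordX
  have gx (u : ℝ × ℝ) (hu : u ∈ V) := hasDx_component H.isOpen H.smooth hu coordY
  have zx (u : ℝ × ℝ) (hu : u ∈ V) := hasDx_component H.isOpen H.smooth hu coordZ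
  have fy (u : ℝ × ℝ) (hu : u ∈ V) := hasDy_component H.isOpen H.smooth hu coordX
  have gy (u : ℝ × ℝ) (hu : u ∈ V) := hasDy_component H.isOpen H.smooth hu coordY
  have zy (u : ℝ × ℝ) (hu : u ∈ V) := hasDy_component H.isOpen H.smooth hu coordZ
  have fx' (u : ℝ × ℝ) (hu : u ∈ V) := hasDx_component H'.isOpen H'.smooth hu coordX
  have gx' (u : ℝ × ℝ) (hu : u ∈ V) := hasDx_component H'.isOpen H'.smooth hu coordY
  have zx' (u : ℝ × ℝ) (hu : u ∈ V) := hasDx_component H'.isOpen H'.smooth hu coordZ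
  have fy' (u : ℝ × ℝ) (hu : u ∈ V) := hasDy_component H'.isOpen H'.smooth hu coordX
  have gy' (u : ℝ × ℝ) (hu : u ∈ V) := hasDy_component H'.isOpen H'.smooth hu coordY
  have zy' (u : ℝ × ℝ) (hu : u ∈ V) := hasDy_component H'.isOpen H'.smooth hu coordZ
  have cX (P : H1) : coordX P = P.1 := rfl
  have cY (P : H1) : coordY P = P.2.1 := rfl
  have cZ (P : H1) : coordZ P = P.2.2 := rfl
  simp only [cX, cY, cZ] at fx gx zx fy gy zy fx' gx' zx' fy' gy' zy'
  have hs1 := H.smooth.fst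
  have hs2 := H.smooth.snd.fst
  have hs1' := H'.smooth.fst
  have hs2' := H'.smooth.snd.fst
  obtain ⟨A, hA⟩ := exists_const_of_slices
    (F := fun v => (X' v).1 - (ρ * (X v).1 - κ * (X v).2.1)) H.isOpen hV
    (hs1'.sub ((contDiffOn_const.mul hs1).sub (contDiffOn_const.mul hs2)))
    (fun u hu => ((fx' u hu).sub (((fx u hu).const_mul ρ).sub
      ((gx u hu).const_mul κ))).congr_deriv (by rw [ep u hu]; ring))
    (fun u hu => ((fy' u hu).sub (((fy u hu).const_mul ρ).sub
      ((gy u hu).const_mul κ))).congr_deriv (by rw [er u hu]; ring))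
  obtain ⟨B, hB⟩ := exists_const_of_slices
    (F := fun v => (X' v).2.1 - (κ * (X v).1 + ρ * (X v).2.1)) H.isOpen hV
    (hs2'.sub ((contDiffOn_const.mul hs1).add (contDiffOn_const.mul hs2)))
    (fun u hu => ((gx' u hu).sub (((fx u hu).const_mul κ).add
      ((gx u hu).const_mul ρ))).congr_deriv (by rw [eq u hu]; ring))
    (fun u hu => ((gy' u hu).sub (((fy u hu).const_mul κ).add
      ((gy u hu).const_mul ρ))).congr_deriv (by rw [es u hu]; ring))
  have ef (u : ℝ × ℝ) (hu : u ∈ V) : (X' u).1 = ρ * (X u).1 - κ * (X u).2.1 + A := by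
    linarith [hA u hu]
  have eg (u : ℝ × ℝ) (hu : u ∈ V) : (X' u).2.1 = κ * (X u).1 + ρ * (X u).2.1 + B := by
    linarith [hB u hu]
  -- The correction by `A` and `B` is the vertical twist of the left translation by (A, B); equality
  -- of Θ on both coordinate vectors makes the rest constant.
  obtain ⟨C, hC⟩ := exists_const_of_slices
    (F := fun v => (X' v).2.2 - ((X v).2.2 + (B * (X' v).1 - A * (X' v).2.1))) H.isOpen hV
    (H'.smooth.snd.snd.sub (H.smooth.snd.snd.add
      ((contDiffOn_const.mul hs1').sub (contDiffOn_const.mul hs2'))))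
    (fun u hu => ((zx' u hu).sub ((zx u hu).add (((fx' u hu).const_mul B).sub
      ((gx' u hu).const_mul A)))).congr_deriv (by
        rw [H'.dX_third hu, H.dX_third hu, ef u hu, eg u hu, ep u hu, eq u hu]
        linear_combination ((X u).2.1 * (dX X u).1 - (X u).1 * (dX X u).2.1) * hrot))
    (fun u hu => ((zy' u hu).sub ((zy u hu).add (((fy' u hu).const_mul B).sub
      ((gy' u hu).const_mul A)))).congr_deriv (by
        rw [(H'.dY_eq hu).2.2, (H.dY_eq hu).2.2, hm u hu, ef u hu, eg u hu, er u hu, es u hu]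
        linear_combination ((X u).2.1 * (dY X u).1 - (X u).1 * (dY X u).2.1) * hrot))
  refine ⟨_, isRigidMotion_motion ρ κ A B C hrot, fun u hu => ?_⟩
  refine Prod.ext (ef u hu) (Prod.ext (eg u hu) ?_)
  have h1 := hC u hu
  rw [ef u hu, eg u hu] at h1
  change (X' u).2.2 = _ + C + _ - _
  linear_combination h1

end Uniqueness

end Heis

/-! ### Assembly of the five statements -/

theorem theorem1p1 (c : ℝ) :
    -- existence of a surface is equivalent to existence of a solution
    ((∃ (S : Set Heis.H1) (e : Heis.H1 → Heis.H1), S.Nonempty ∧ Heis.IsCMCSurface c S e) ↔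
      ∃ (U : Set (ℝ × ℝ)) (α : ℝ × ℝ → ℝ),
        IsOpen U ∧ U.Nonempty ∧ Heis.IsLienardSolution c U α) ∧
    -- surfaces give solutions: the α-function in any compatible coordinate system
    (∀ (S : Set Heis.H1) (e : Heis.H1 → Heis.H1), Heis.IsCMCSurface c S e →
      (∀ p ∈ S, ∃ U X, Heis.IsCompatibleChart S e U X ∧ p ∈ X '' U) ∧
      (∃ A : Heis.H1 → ℝ, Heis.IsAlphaFunction S e A) ∧
      ∀ A : Heis.H1 → ℝ, Heis.IsAlphaFunction S e A →
        ∀ U X, Heis.IsCompatibleChart S e U X →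
          Heis.IsLienardSolution c U (fun u => A (X u))) ∧
    -- solutions give surfaces: every solution, and every pair `k`, `h`, is realized locally
    (∀ (U : Set (ℝ × ℝ)) (α : ℝ × ℝ → ℝ), IsOpen U → Heis.IsLienardSolution c U α →
      ∀ u₀ ∈ U,
        (∃ V ⊆ U, IsOpen V ∧ u₀ ∈ V ∧ ∃ E G, Heis.AreAntiderivs c α E G V) ∧
        ∀ V ⊆ U, IsOpen V → u₀ ∈ V → ∀ E G, Heis.AreAntiderivs c α E G V →
          ∀ k h : ℝ → ℝ, ContDiffOn ℝ ∞ k (Prod.snd '' V) → ContDiffOn ℝ ∞ h (Prod.snd '' V) →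
            ∃ W ⊆ V, IsOpen W ∧ u₀ ∈ W ∧ ∃ X : ℝ × ℝ → Heis.H1,
              Heis.IsRealization c α W X ∧
              Heis.HasFrameCoeffs α W X (Heis.coeffA α E G h) (Heis.coeffB α E k) ∧
              Heis.HasInducedMetric W X (Heis.coeffA α E G h) (Heis.coeffB α E k)) ∧
    -- the induced metric of every such surface arises from exactly one pair `k`, `h`
    (∀ (V : Set (ℝ × ℝ)) (α : ℝ × ℝ → ℝ) (X : ℝ × ℝ → Heis.H1),
      (∀ y : ℝ, IsPreconnected {x : ℝ | (x, y) ∈ V}) → Heis.IsRealization c α V X →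
      ∃ a b : ℝ × ℝ → ℝ, ContDiffOn ℝ ∞ a V ∧ ContDiffOn ℝ ∞ b V ∧ (∀ u ∈ V, b u ≠ 0) ∧
        Heis.HasFrameCoeffs α V X a b ∧ Heis.HasInducedMetric V X a b ∧
        ∀ E G, Heis.AreAntiderivs c α E G V →
          ∃ k h : ℝ → ℝ,
            ContDiffOn ℝ ∞ k (Prod.snd '' V) ∧ ContDiffOn ℝ ∞ h (Prod.snd '' V) ∧
            (∀ u ∈ V, a u = Heis.coeffA α E G h u ∧ |b u| = Heis.coeffB α E k u) ∧
            ∀ k' h' : ℝ → ℝ,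
              (∀ u ∈ V, a u = Heis.coeffA α E G h' u ∧ |b u| = Heis.coeffB α E k' u) →
              Set.EqOn k' k (Prod.snd '' V) ∧ Set.EqOn h' h (Prod.snd '' V)) ∧
    -- `c`, `α` and the metric determine the surface up to a Heisenberg rigid motion
    (∀ (V : Set (ℝ × ℝ)) (α a b : ℝ × ℝ → ℝ) (X X' : ℝ × ℝ → Heis.H1),
      IsPreconnected V → Heis.IsRealization c α V X → Heis.IsRealization c α V X' →
      Heis.HasFrameCoeffs α V X a b → Heis.HasFrameCoeffs α V X' a b →
      ∃ Φ : Heis.H1 ≃ Heis.H1, Heis.IsRigidMotion Φ ∧ ∀ u ∈ V, X' u = Φ (X u)) := by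
  have toSolution (S : Set Heis.H1) (e : Heis.H1 → Heis.H1) (hS : Heis.IsCMCSurface c S e) :
      (∀ p ∈ S, ∃ U X, Heis.IsCompatibleChart S e U X ∧ p ∈ X '' U) ∧
      (∃ A : Heis.H1 → ℝ, Heis.IsAlphaFunction S e A) ∧
      ∀ A : Heis.H1 → ℝ, Heis.IsAlphaFunction S e A →
        ∀ U X, Heis.IsCompatibleChart S e U X →
          Heis.IsLienardSolution c U (fun u => A (X u)) := by
    refine ⟨fun p hp => hS.exists_compatibleChart hp, ?_, fun A hA U X hX =>
      (Heis.IsCompatibleChart.structureEqs hS hX hA).isLienardSolution⟩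
    have hex (p : Heis.H1) : ∃ a : ℝ, p ∈ S →
        a • Heis.cxJ p (e p) + Heis.reeb p ∈ Heis.tangentPlane S p := by
      by_cases hp : p ∈ S
      · obtain ⟨U, X, hX, u, hu, rfl⟩ := hS.exists_compatibleChart hp
        obtain ⟨a, ha⟩ := Heis.IsCompatibleChart.exists_alpha hS hX hu
        exact ⟨a, fun _ => ha⟩
      · exact ⟨0, fun h => absurd h hp⟩
    choose A hA using hex
    exact ⟨A, hA⟩
  refine ⟨⟨?_, ?_⟩, toSolution, ?_, ?_, ?_⟩
  · rintro ⟨S, e, ⟨p, hp⟩, hS⟩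
    obtain ⟨hcharts, ⟨A, hA⟩, hsol⟩ := toSolution S e hS
    obtain ⟨U, X, hX, u, hu, -⟩ := hcharts p hp
    exact ⟨U, _, hX.isChart.isSmoothEmbedding.isOpen, ⟨u, hu⟩, hsol A hA U X hX⟩
  · rintro ⟨U, α, hU, ⟨u₀, hu₀⟩, hα⟩
    obtain ⟨V, hVU, hV, huV, E, G, hEG⟩ := Heis.exists_areAntiderivs (c := c) hU hα.1 hu₀
    obtain ⟨W, -, -, huW, X, ⟨-, e, A, hS, -⟩, -⟩ := Heis.exists_isRealization hV (hα.mono hVU)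
      huV hEG (k := fun _ => 0) (h := fun _ => 0) contDiffOn_const contDiffOn_const
    exact ⟨X '' W, e, ⟨X u₀, u₀, huW, rfl⟩, hS⟩
  · intro U α hU hα u₀ hu₀
    exact ⟨Heis.exists_areAntiderivs hU hα.1 hu₀, fun V hVU hV huV E G hEG k h hk hh =>
      Heis.exists_isRealization hV (hα.mono hVU) huV hEG hk hh⟩
  · intro V α X hsec hX
    exact hX.structureEqs.exists_frameCoeffs hsec
  · intro V α a b X X' hV hX hX' hab hab'
    have H := hX.structureEqs
    have H' := hX'.structureEqs
    -- The frame coefficients return the invariants: m = 1 / (b √(1+α²)) and n = a/b.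
    refine Heis.StructureEqs.exists_rigidMotion hV H H' (fun u hu => ?_) fun u hu => ?_
    · obtain ⟨h1, -⟩ := H.frameCoeffs_eq hab hu
      obtain ⟨h2, -⟩ := H'.frameCoeffs_eq hab' hu
      have hne : √(1 + α u ^ 2) * b u ≠ 0 := fun h0 => by simp [h0] at h1
      exact mul_left_cancel₀ hne (h2.trans h1.symm)
    · obtain ⟨h1, h1'⟩ := H.frameCoeffs_eq hab hu
      obtain ⟨-, h2'⟩ := H'.frameCoeffs_eq hab' hu
      have hne : b u ≠ 0 := fun h0 => by simp [h0] at h1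
      exact mul_left_cancel₀ hne (h2'.symm.trans h1')
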